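/- Let $n\ge 1$, $\sigma>0$ and $z^*\in\mathbb{C}_1^n=\{z\in\mathbb{C}^n:|z_j|=1\ \forall j\}$. One observes $Y=z^*(z^*)^{\mathsf H}+\sigma W\in\mathbb{C}^{n\times n}$, where $W_{jj}=0$, the entries $W_{jk}$ ($j<k$) are independent standard complex Gaussians (independent real and imaginary parts, each $N(0,1/2)$), and $W_{kj}=\overline{W_{jk}}$. With $\langle A,B\rangle=\mathrm{Tr}(A^{\mathsf H}B)$, let $\hat z^{\mathrm{MLE}}$ be a maximizer of $\langle Y,zz^{\mathsf H}\rangle$ over $z\in\mathbb{C}_1^n$, and let $\hat Z^{\mathrm{BM},m}$ be a maximizer of $\langle Y,Z\rangle$ over all Hermitian positive semidefinite $Z\in\mathbb{C}^{n\times n}$ with $\mathrm{rank}(Z)\le m$ and $Z_{jj}=1$ for all $j$ (for $m\ge n$ the rank constraint is void and this is the semidefinite programming relaxation). 1. There is an absolute constant $C>0$ such that for all $n\ge1$, $m\ge 2$, $\sigma>0$, $z^*\in\mathbb{C}_1^n$, and all random variables $\hat Z^{\mathrm{BM},m}$, $\hat z^{\mathrm{MLE}}$ that are almost surely such maximizers,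 $$\mathbb{E}\Big[\frac1{n^2}\big\|\hat Z^{\mathrm{BM},m}-\hat z^{\mathrm{MLE}}(\hat z^{\mathrm{MLE}})^{\mathsf H}\big\|_F^2\Big]\le C\exp\Big(-\frac{n}{8\sigma^2}\Big)+2n^{-10}.$$ 2. There is an absolute constant $C'>0$ such that for all $n\ge 2$, $m\ge2$, $z^*\in\mathbb{C}_1^n$ and all $0<\sigma\le\min\{C'\sqrt n,\sqrt{n/(9\log n)}\}$, with probability at least $1-1/n$ every pair of maximizers satisfies $\hat Z^{\mathrm{BM},m}=\hat z^{\mathrm{MLE}}(\hat z^{\mathrm{MLE}})^{\mathsf H}$. -/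

import Mathlib

open MeasureTheory ProbabilityTheory
open scoped ComplexOrder

noncomputable section

namespace PhaseSync

/-- The standard complex Gaussian distribution: real and imaginary parts are independent centred
real Gaussians of variance `1/2`, so that `E |x|² = 1`. -/
def stdComplexGaussian : Measure ℂ :=
  ((gaussianReal 0 (1 / 2)).prod (gaussianReal 0 (1 / 2))).map
    (fun p : ℝ × ℝ => (p.1 : ℂ) + (p.2 : ℂ) * Complex.I)

/-- `ℂ₁ⁿ`: complex vectors all of whose coordinates have modulus one. -/
def phases (n : ℕ) : Set (Fin n → ℂ) := {z | ∀ j, ‖z j‖ = 1}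

/-- The rank-one matrix `z zᴴ`. -/
def outer {n : ℕ} (z : Fin n → ℂ) : Matrix (Fin n) (Fin n) ℂ :=
  Matrix.vecMulVec z (star z)

/-- The entries `ξ j k` with `j < k` are independent standard complex Gaussians. Nothing is required
of the other entries, which are not used. -/
structure IsNoise {n : ℕ} {Ω : Type*} [MeasurableSpace Ω] (μ : Measure Ω)
    (ξ : Fin n → Fin n → Ω → ℂ) : Prop where
  law : ∀ j k, j < k → HasLaw (ξ j k) stdComplexGaussian μ
  indep : iIndepFun (fun (p : {p : Fin n × Fin n // p.1 < p.2}) => ξ p.1.1 p.1.2) μ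

/-- The noise matrix `W`: the given entries above the diagonal, zeros on the diagonal, and complex
conjugates below it. -/
def noiseMatrix {n : ℕ} (w : Fin n → Fin n → ℂ) : Matrix (Fin n) (Fin n) ℂ :=
  Matrix.of fun j k => if j < k then w j k else if k < j then star (w k j) else 0

/-- The data matrix `Y = z* (z*)ᴴ + σ W`. -/
def observation {n : ℕ} (zs : Fin n → ℂ) (σ : ℝ) (w : Fin n → Fin n → ℂ) :
    Matrix (Fin n) (Fin n) ℂ :=
  outer zs + (σ : ℂ) • noiseMatrix w

/-- The Frobenius inner product `⟨A, B⟩ = Tr (Aᴴ B)`. -/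
def frobInner {n : ℕ} (A B : Matrix (Fin n) (Fin n) ℂ) : ℂ := (A.conjTranspose * B).trace

/-- The Frobenius norm. -/
def frobNorm {n : ℕ} (A : Matrix (Fin n) (Fin n) ℂ) : ℝ := √(∑ j, ∑ k, ‖A j k‖ ^ 2)

/-- `z` is a maximum likelihood estimate: a maximizer of `⟨Y, z zᴴ⟩` over `ℂ₁ⁿ`. For Hermitian
matrices the inner product is real; `re` only serves to compare values in `ℝ`. -/
def IsMLE {n : ℕ} (Y : Matrix (Fin n) (Fin n) ℂ) (z : Fin n → ℂ) : Prop :=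
  z ∈ phases n ∧ IsMaxOn (fun u => (frobInner Y (outer u)).re) (phases n) z

/-- Feasible set of the Burer-Monteiro factorization: Hermitian positive semidefinite matrices of
rank at most `m` with unit diagonal. -/
def bmFeasible (n m : ℕ) : Set (Matrix (Fin n) (Fin n) ℂ) :=
  {Z | Z.IsHermitian ∧ Z.rank ≤ m ∧ Z.PosSemidef ∧ ∀ j, Z j j = 1}

/-- `Z` is a solution of the Burer-Monteiro factorization: a global maximizer of `⟨Y, Z⟩`. -/
def IsBM {n : ℕ} (m : ℕ) (Y Z : Matrix (Fin n) (Fin n) ℂ) : Prop :=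
  Z ∈ bmFeasible n m ∧ IsMaxOn (fun X => (frobInner Y X).re) (bmFeasible n m) Z

end PhaseSync

end

/-!
Write the data as `n (zs zsᴴ / n + A)`, where `A = (σ / n) W` has operator norm at most `1 / 10000`
unless `σ / √n` exceeds a constant or `W` has an exceptionally large norm (a net argument).

*Reduction to weak coordinates.* A maximum likelihood estimate `z` is a fixed point of the power
method: its local field `h = (zs zsᴴ / n + A) z` satisfies `h j = |h j| z j`. The matrix
`diag |h| - (zs zsᴴ / n + A)` annihilates `z`, and on `zᗮ` its quadratic form is at least
`∑ |h j| |r j|² - |r|² / 40`. As the Burer-Monteiro solution `Z = ∑ uᵢ uᵢᴴ` does at least as well as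
`z zᴴ`, the sum of these forms over the `uᵢ` is nonpositive. Hence the components of the `uᵢ`
orthogonal to `z` can only be sustained by the coordinates with `|h j| < 1 / 20`, and
`‖Z - z zᴴ‖² / n²` is at most a constant times the fraction of such weak coordinates
(`sum_norm_sq_residual_le`, `frobNorm_gram_sub_outer_sq_le`). The rank plays no role beyond
`rank (z zᴴ) ≤ m`.

*Decoupling.* It remains to see that a coordinate is weak with exponentially small probability only,
although `z` depends on `A`. For this `z` is compared with the fixed point `x` of a clipped power map
(`clippedPower`), in which the phase is replaced by a Lipschitz function. The clipped map is a
contraction, because a change of the overlap with `zs` moves the signal radially and so hardly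
affects phases (`norm_clip_radial_sub_le`). The two maps agree at strong coordinates, which bounds
the number of weak coordinates of `z` by twice the number of `j` with `|(A x) j| > 4 / 5`
(`card_weakCoords_le`). Being a contraction, the clipped map is stable under removing row and column
`j` of `A`, so `x` may be replaced here by an iterate of the leave-one-out map
(`lt_norm_apply_iterate_leaveOut`). That iterate is independent of row `j`, and a Gaussian tail bound
gives the probability `4 exp (-(9 / 32) n / σ²)` (`noiseLaw_leaveOutNoisy_le`).

The exponent `9 / 32` exceeds `1 / 8`, as needed for the expectation, and `2 / 9`, as needed for the
union bound over `n` coordinates when `σ² ≤ n / (9 log n)`.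
-/

noncomputable section

namespace PhaseSync

variable {n : ℕ}

/-! ### The clipped phase map -/

/-- The phase `h / ‖h‖`, made Lipschitz by flattening it on the disc of radius `1 / 20`. -/
def clip (h : ℂ) : ℂ := h / (max ‖h‖ (1 / 20) : ℝ)

lemma norm_clip_le (h : ℂ) : ‖clip h‖ ≤ 1 := by
  have hM : (0 : ℝ) < max ‖h‖ (1 / 20) := lt_max_of_lt_right (by norm_num)
  rw [clip, norm_div, Complex.norm_real, Real.norm_of_nonneg hM.le, div_le_one hM]
  exact le_max_left _ _

lemma clip_of_le {h : ℂ} (hh : 1 / 20 ≤ ‖h‖) : clip h = h / ‖h‖ := by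
  rw [clip, max_eq_left hh]

lemma norm_clip_sub_clip_le (h k : ℂ) : ‖clip h - clip k‖ ≤ 40 * ‖h - k‖ := by
  have hM : (1 / 20 : ℝ) ≤ max ‖h‖ (1 / 20) := le_max_right _ _
  have hN : (1 / 20 : ℝ) ≤ max ‖k‖ (1 / 20) := le_max_right _ _
  have hkN : ‖k‖ ≤ max ‖k‖ (1 / 20) := le_max_left _ _
  have hMN : |max ‖k‖ (1 / 20) - max ‖h‖ (1 / 20)| ≤ ‖h - k‖ := by
    refine (abs_max_sub_max_le_abs _ _ _).trans ?_
    rw [norm_sub_rev]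
    exact abs_norm_sub_norm_le k h
  unfold clip
  generalize max ‖h‖ (1 / 20) = M at *
  generalize max ‖k‖ (1 / 20) = N at *
  have hM0 : 0 < M := by linarith
  have hN0 : 0 < N := by linarith
  have hMc : (M : ℂ) ≠ 0 := by exact_mod_cast hM0.ne'
  have hNc : (N : ℂ) ≠ 0 := by exact_mod_cast hN0.ne'
  have key : h / (M : ℂ) - k / (N : ℂ) = ((h - k) + (k / N) * ((N - M : ℝ) : ℂ)) / M := by
    push_cast
    field_simp
    ring
  have hk : ‖k / (N : ℂ)‖ ≤ 1 := by
    rw [norm_div, Complex.norm_real, Real.norm_of_nonneg hN0.le, div_le_one hN0]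
    exact hkN
  rw [key, norm_div, Complex.norm_real, Real.norm_of_nonneg hM0.le, div_le_iff₀ hM0]
  calc ‖(h - k) + (k / N) * ((N - M : ℝ) : ℂ)‖ ≤ ‖h - k‖ + ‖k / (N : ℂ)‖ * |N - M| := by
        refine (norm_add_le _ _).trans ?_
        rw [norm_mul, Complex.norm_real, Real.norm_eq_abs]
    _ ≤ ‖h - k‖ + 1 * ‖h - k‖ := by gcongr
    _ ≤ 40 * ‖h - k‖ * M := by nlinarith [norm_nonneg (h - k)]

/-- Off the flattened disc `clip` is invariant under positive scaling. -/
lemma clip_real_mul {t : ℝ} (ht : 0 < t) {h : ℂ} (hh : 1 / 20 ≤ ‖h‖)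
    (hth : 1 / 20 ≤ ‖(t : ℂ) * h‖) : clip (t * h) = clip h := by
  have ht' : (t : ℂ) ≠ 0 := by exact_mod_cast ht.ne'
  rw [clip_of_le hh, clip_of_le hth, norm_mul, Complex.norm_real, Real.norm_of_nonneg ht.le,
    Complex.ofReal_mul, mul_div_mul_left _ _ ht']

/-- The clipped phase reacts to a change of the radial signal `a` only in proportion to the
perturbation `e`: a purely radial change does not affect a phase. -/
lemma norm_clip_radial_sub_le {a b : ℝ} (ha : 9 / 10 ≤ a) (hb : 9 / 10 ≤ b) {z : ℂ} (hz : ‖z‖ = 1)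
    (e : ℂ) : ‖clip (a * z + e) - clip (b * z + e)‖ ≤ 160 * |a - b| * ‖e‖ := by
  rcases le_or_gt (1 / 4) ‖e‖ with he | he
  · refine (norm_clip_sub_clip_le _ _).trans ?_
    have : (a : ℂ) * z + e - (b * z + e) = ((a - b : ℝ) : ℂ) * z := by push_cast; ring
    rw [this, norm_mul, Complex.norm_real, Real.norm_eq_abs, hz, mul_one]
    nlinarith [abs_nonneg (a - b)]
  · have scale : ∀ t : ℝ, 9 / 10 ≤ t → clip (t * z + e) = clip (z + e / t) := by
      intro t ht
      have ht0 : 0 < t := by linarith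
      have htc : (t : ℂ) ≠ 0 := by exact_mod_cast ht0.ne'
      have h1 : (t : ℂ) * z + e = t * (z + e / t) := by field_simp
      have h2 : ‖e / (t : ℂ)‖ ≤ 1 / 3 := by
        rw [norm_div, Complex.norm_real, Real.norm_of_nonneg ht0.le, div_le_iff₀ ht0]
        linarith
      have h3 : 1 / 20 ≤ ‖z + e / t‖ := by
        have := norm_sub_norm_le z (-(e / t))
        rw [sub_neg_eq_add, norm_neg, hz] at this
        linarith
      have h4 : 1 / 20 ≤ ‖(t : ℂ) * (z + e / t)‖ := by
        rw [← h1]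
        have := norm_sub_norm_le ((t : ℂ) * z) (-e)
        rw [sub_neg_eq_add, norm_neg, norm_mul, hz, Complex.norm_real,
          Real.norm_of_nonneg ht0.le] at this
        linarith
      rw [h1, clip_real_mul ht0 h3 h4]
    rw [scale a ha, scale b hb]
    refine (norm_clip_sub_clip_le _ _).trans ?_
    have ha0 : 0 < a := by linarith
    have hb0 : 0 < b := by linarith
    have hac : (a : ℂ) ≠ 0 := by exact_mod_cast ha0.ne'
    have hbc : (b : ℂ) ≠ 0 := by exact_mod_cast hb0.ne'
    have h5 : z + e / (a : ℂ) - (z + e / b) = e * ((b - a : ℝ) : ℂ) / ((a * b : ℝ) : ℂ) := by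
      push_cast
      field_simp
      ring
    rw [h5, norm_div, norm_mul, Complex.norm_real, Complex.norm_real, Real.norm_eq_abs,
      Real.norm_of_nonneg (by positivity : 0 ≤ a * b), abs_sub_comm b a, ← mul_div_assoc,
      div_le_iff₀ (by positivity)]
    have hab : (1 / 4 : ℝ) ≤ a * b := by nlinarith
    nlinarith [mul_nonneg (norm_nonneg e) (abs_nonneg (a - b))]

/-! ### The clipped power map and its fixed point -/

/-- Vectors with the Euclidean norm. -/
abbrev Vec (n : ℕ) := EuclideanSpace ℂ (Fin n)

/-- The vectors all of whose coordinates have modulus at most one. -/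
def polydisc (n : ℕ) : Set (Vec n) := {x | ∀ j, ‖x j‖ ≤ 1}

/-- The overlap of `x` with the signal `zs`, truncated below at `9 / 10`. -/
def overlap (zs x : Vec n) : ℝ := max (9 / 10) ((inner ℂ zs x).re / n)

/-- One step of the power method for `zs zsᴴ / n + A`, in which the signal part is kept at overlap
at least `9 / 10` and the projection to phases is replaced by `clip`. -/
def clippedPower (zs : Vec n) (A : Vec n →L[ℂ] Vec n) (x : Vec n) : Vec n :=
  WithLp.toLp 2 fun j => clip (overlap zs x * zs j + A x j)

@[simp] lemma clippedPower_apply (zs : Vec n) (A : Vec n →L[ℂ] Vec n) (x : Vec n) (j : Fin n) :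
    clippedPower zs A x j = clip (overlap zs x * zs j + A x j) := rfl

lemma clippedPower_mem_polydisc (zs : Vec n) (A : Vec n →L[ℂ] Vec n) (x : Vec n) :
    clippedPower zs A x ∈ polydisc n := fun _ => norm_clip_le _

lemma norm_le_of_forall_norm_le {x y : Vec n} {c : ℝ} (hc : 0 ≤ c)
    (h : ∀ j, ‖x j‖ ≤ c * ‖y j‖) : ‖x‖ ≤ c * ‖y‖ := by
  have hsq : ‖x‖ ^ 2 ≤ (c * ‖y‖) ^ 2 := by
    rw [mul_pow, EuclideanSpace.norm_sq_eq, EuclideanSpace.norm_sq_eq, Finset.mul_sum]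
    refine Finset.sum_le_sum fun j _ => ?_
    rw [← mul_pow]
    exact pow_le_pow_left₀ (norm_nonneg _) (h j) 2
  exact (pow_le_pow_iff_left₀ (norm_nonneg _) (by positivity) two_ne_zero).1 hsq

lemma norm_sq_le_of_mem_polydisc {x : Vec n} (hx : x ∈ polydisc n) : ‖x‖ ^ 2 ≤ n := by
  rw [EuclideanSpace.norm_sq_eq]
  calc ∑ j, ‖x j‖ ^ 2 ≤ ∑ _j : Fin n, (1 : ℝ) :=
        Finset.sum_le_sum fun j _ => pow_le_one₀ (norm_nonneg _) (hx j)
    _ = n := by simp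

lemma norm_le_of_mem_polydisc {x : Vec n} (hx : x ∈ polydisc n) : ‖x‖ ≤ √n :=
  Real.le_sqrt_of_sq_le (norm_sq_le_of_mem_polydisc hx)

lemma norm_sq_of_forall_norm_eq_one {z : Vec n} (hz : ∀ j, ‖z j‖ = 1) : ‖z‖ ^ 2 = n := by
  rw [EuclideanSpace.norm_sq_eq]
  simp [hz]

lemma abs_overlap_sub_overlap_le {zs : Vec n} (hzs : ∀ j, ‖zs j‖ = 1) (x y : Vec n) :
    |overlap zs x - overlap zs y| * √n ≤ ‖x - y‖ := by
  rcases Nat.eq_zero_or_pos n with rfl | hn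
  · simp
  have hn' : (0 : ℝ) < n := by exact_mod_cast hn
  have h1 : |overlap zs x - overlap zs y| ≤ |(inner ℂ zs x).re / n - (inner ℂ zs y).re / n| := by
    unfold overlap
    refine (abs_max_sub_max_le_max _ _ _ _).trans ?_
    simp
  have h2 : (inner ℂ zs x).re / n - (inner ℂ zs y).re / n = (inner ℂ zs (x - y)).re / n := by
    rw [inner_sub_right, Complex.sub_re, sub_div]
  have h3 : ‖zs‖ = √n := by
    rw [← norm_sq_of_forall_norm_eq_one hzs, Real.sqrt_sq (norm_nonneg _)]
  have h4 : |(inner ℂ zs (x - y)).re| ≤ √n * ‖x - y‖ := by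
    rw [← h3]
    exact (Complex.abs_re_le_norm _).trans (norm_inner_le_norm _ _)
  rw [h2, abs_div, abs_of_pos hn'] at h1
  calc |overlap zs x - overlap zs y| * √n ≤ √n * ‖x - y‖ / n * √n := by
        gcongr
        exact h1.trans (by gcongr)
    _ = ‖x - y‖ * (√n * √n) / n := by ring
    _ = ‖x - y‖ := by rw [Real.mul_self_sqrt hn'.le]; field_simp

/-- The clipped power map halves distances on the polydisc when the noise is small. The signal part
contributes little because of `norm_clip_radial_sub_le`. -/
lemma norm_clippedPower_sub_le {zs : Vec n} (hzs : ∀ j, ‖zs j‖ = 1) {A : Vec n →L[ℂ] Vec n}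
    (hA : ‖A‖ ≤ 1 / 10000) (x : Vec n) {y : Vec n} (hy : y ∈ polydisc n) :
    ‖clippedPower zs A x - clippedPower zs A y‖ ≤ 1 / 2 * ‖x - y‖ := by
  let w : Vec n := WithLp.toLp 2 fun j => clip (overlap zs x * zs j + A y j)
  have h1 : ‖clippedPower zs A x - w‖ ≤ 40 * ‖A (x - y)‖ := by
    refine norm_le_of_forall_norm_le (by norm_num) fun j => ?_
    refine (norm_clip_sub_clip_le _ _).trans_eq ?_
    rw [add_sub_add_left_eq_sub, map_sub]
    rfl
  have h2 : ‖w - clippedPower zs A y‖ ≤ 160 * |overlap zs x - overlap zs y| * ‖A y‖ := by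
    refine norm_le_of_forall_norm_le (by positivity) fun j => ?_
    exact norm_clip_radial_sub_le (le_max_left _ _) (le_max_left _ _) (hzs j) _
  have h3 : ‖A (x - y)‖ ≤ 1 / 10000 * ‖x - y‖ := A.le_of_opNorm_le hA _
  have h4 : ‖A y‖ ≤ 1 / 10000 * √n :=
    (A.le_of_opNorm_le hA _).trans (by gcongr; exact norm_le_of_mem_polydisc hy)
  have h5 := abs_overlap_sub_overlap_le hzs x y
  calc ‖clippedPower zs A x - clippedPower zs A y‖
      ≤ ‖clippedPower zs A x - w‖ + ‖w - clippedPower zs A y‖ := norm_sub_le_norm_sub_add_norm_sub ..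
    _ ≤ 40 * (1 / 10000 * ‖x - y‖) +
        160 * |overlap zs x - overlap zs y| * (1 / 10000 * √n) := by
        refine add_le_add (h1.trans (by gcongr)) (h2.trans (by gcongr))
    _ = 40 / 10000 * ‖x - y‖ + 160 / 10000 * (|overlap zs x - overlap zs y| * √n) := by ring
    _ ≤ 1 / 2 * ‖x - y‖ := by nlinarith [norm_nonneg (x - y)]

lemma isClosed_polydisc : IsClosed (polydisc n) := by
  simp only [polydisc, Set.ofPred_forall]
  exact isClosed_iInter fun j => isClosed_le (by fun_prop) continuous_const

lemma mem_polydisc_of_forall_norm_eq_one {z : Vec n} (hz : ∀ j, ‖z j‖ = 1) : z ∈ polydisc n :=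
  fun j => (hz j).le

lemma iterate_clippedPower_mem_polydisc {zs : Vec n} (hzs : ∀ j, ‖zs j‖ = 1)
    (A : Vec n →L[ℂ] Vec n) (k : ℕ) : (clippedPower zs A)^[k] zs ∈ polydisc n := by
  cases k with
  | zero => exact mem_polydisc_of_forall_norm_eq_one hzs
  | succ k =>
    rw [Function.iterate_succ_apply']
    exact clippedPower_mem_polydisc _ _ _

lemma exists_clippedPower_eq_self {zs : Vec n} (hzs : ∀ j, ‖zs j‖ = 1) {A : Vec n →L[ℂ] Vec n}
    (hA : ‖A‖ ≤ 1 / 10000) : ∃ x, clippedPower zs A x = x := by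
  have hmaps : Set.MapsTo (clippedPower zs A) (polydisc n) (polydisc n) :=
    fun x _ => clippedPower_mem_polydisc _ _ _
  have hcontr : ContractingWith (1 / 2) (hmaps.restrict (clippedPower zs A) _ _) := by
    refine ⟨by rw [← NNReal.coe_lt_coe]; norm_num, LipschitzWith.of_dist_le_mul ?_⟩
    rintro ⟨x, hx⟩ ⟨y, hy⟩
    rw [Subtype.dist_eq, Subtype.dist_eq, dist_eq_norm, dist_eq_norm]
    simpa using norm_clippedPower_sub_le hzs hA x hy
  obtain ⟨x, -, hx, -⟩ := hcontr.exists_fixedPoint' (isClosed_polydisc.isComplete) hmaps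
    (mem_polydisc_of_forall_norm_eq_one hzs) (edist_ne_top _ _)
  exact ⟨x, hx⟩

lemma mem_polydisc_of_clippedPower_eq_self {zs : Vec n} {A : Vec n →L[ℂ] Vec n} {x : Vec n}
    (hx : clippedPower zs A x = x) : x ∈ polydisc n :=
  hx ▸ clippedPower_mem_polydisc zs A x

lemma norm_iterate_clippedPower_sub_le {zs : Vec n} (hzs : ∀ j, ‖zs j‖ = 1)
    {A : Vec n →L[ℂ] Vec n} (hA : ‖A‖ ≤ 1 / 10000) {x : Vec n} (hx : clippedPower zs A x = x)
    (k : ℕ) : ‖(clippedPower zs A)^[k] zs - x‖ ≤ (1 / 2) ^ k * (2 * √n) := by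
  have hxP := mem_polydisc_of_clippedPower_eq_self hx
  induction k with
  | zero =>
    have h1 := norm_le_of_mem_polydisc (mem_polydisc_of_forall_norm_eq_one hzs)
    have h2 := norm_le_of_mem_polydisc hxP
    have h3 := norm_sub_le zs x
    simp only [Function.iterate_zero, id_eq, pow_zero, one_mul]
    linarith
  | succ k ih =>
    rw [Function.iterate_succ_apply']
    have := norm_clippedPower_sub_le hzs hA ((clippedPower zs A)^[k] zs) hxP
    rw [hx] at this
    refine this.trans ?_
    rw [pow_succ]
    nlinarith

/-! ### Leaving one row and column out -/

/-- The coordinate projection that sets coordinate `j` to zero. -/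
def eraseCoord (j : Fin n) : Vec n →L[ℂ] Vec n :=
  Matrix.toEuclideanCLM (𝕜 := ℂ) (Matrix.diagonal fun l => if l = j then 0 else 1)

@[simp] lemma eraseCoord_apply (j : Fin n) (x : Vec n) (l : Fin n) :
    eraseCoord j x l = if l = j then 0 else x l := by
  simp [eraseCoord, Matrix.mulVec_diagonal]

/-- The compression of `A` obtained by removing row and column `j`. -/
def leaveOut (j : Fin n) (A : Vec n →L[ℂ] Vec n) : Vec n →L[ℂ] Vec n :=
  eraseCoord j ∘L A ∘L eraseCoord j

lemma leaveOut_apply (j : Fin n) (A : Vec n →L[ℂ] Vec n) (x : Vec n) :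
    leaveOut j A x = eraseCoord j (A (eraseCoord j x)) := rfl

lemma norm_eraseCoord_apply_le (j : Fin n) (x : Vec n) : ‖eraseCoord j x‖ ≤ ‖x‖ := by
  rw [← one_mul ‖x‖]
  refine norm_le_of_forall_norm_le zero_le_one fun l => ?_
  rw [eraseCoord_apply, one_mul]
  split_ifs <;> simp

lemma norm_leaveOut_le (j : Fin n) (A : Vec n →L[ℂ] Vec n) : ‖leaveOut j A‖ ≤ ‖A‖ := by
  refine ContinuousLinearMap.opNorm_le_bound _ (norm_nonneg _) fun x => ?_
  rw [leaveOut_apply]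
  refine (norm_eraseCoord_apply_le j _).trans ((A.le_opNorm _).trans ?_)
  exact mul_le_mul_of_nonneg_left (norm_eraseCoord_apply_le j x) (norm_nonneg _)

lemma norm_sub_leaveOut_apply_le (j : Fin n) (A : Vec n →L[ℂ] Vec n) {x : Vec n}
    (hx : x ∈ polydisc n) : ‖A x - leaveOut j A x‖ ≤ ‖A x j‖ + ‖A‖ := by
  have h1 : A x - leaveOut j A x =
      EuclideanSpace.single j (A x j) + eraseCoord j (A (x - eraseCoord j x)) := by
    ext l
    by_cases hl : l = j
    · subst hl; simp [leaveOut_apply]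
    · simp [leaveOut_apply, hl]
  have h2 : x - eraseCoord j x = EuclideanSpace.single j (x j) := by
    ext l
    by_cases hl : l = j
    · subst hl; simp
    · simp [hl]
  rw [h1, h2]
  refine (norm_add_le _ _).trans ?_
  gcongr
  · simp
  · refine (norm_eraseCoord_apply_le _ _).trans ((A.le_opNorm _).trans ?_)
    rw [PiLp.norm_single]
    exact mul_le_of_le_one_right (norm_nonneg _) (hx j)

/-- If the noise pushes coordinate `j` of the fixed point far off, then it already does so to an
iterate of the leave-one-out map, which does not involve row `j` of the noise. -/
lemma lt_norm_apply_iterate_leaveOut {zs : Vec n} (hzs : ∀ j, ‖zs j‖ = 1) {A : Vec n →L[ℂ] Vec n}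
    (hA : ‖A‖ ≤ 1 / 10000) {x : Vec n} (hx : clippedPower zs A x = x) {j : Fin n}
    (hj : 4 / 5 < ‖A x j‖) {k : ℕ} (hk : (1 / 2 : ℝ) ^ k * (2 * √n) ≤ 1) :
    3 / 4 < ‖A ((clippedPower zs (leaveOut j A))^[k] zs) j‖ := by
  have hA' : ‖leaveOut j A‖ ≤ 1 / 10000 := (norm_leaveOut_le j A).trans hA
  obtain ⟨y, hy⟩ := exists_clippedPower_eq_self hzs hA'
  have hyP := mem_polydisc_of_clippedPower_eq_self hy
  set v := (clippedPower zs (leaveOut j A))^[k] zs with hv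
  have h1 : ‖clippedPower zs A y - clippedPower zs (leaveOut j A) y‖ ≤
      40 * ‖A y - leaveOut j A y‖ := by
    refine norm_le_of_forall_norm_le (by norm_num) fun l => ?_
    refine (norm_clip_sub_clip_le _ _).trans_eq ?_
    rw [add_sub_add_left_eq_sub]
    rfl
  have h2 : ‖x - y‖ ≤ 80 * (‖A y j‖ + ‖A‖) := by
    have h3 := norm_clippedPower_sub_le hzs hA x hyP
    have h4 := norm_sub_leaveOut_apply_le j A hyP
    have h5 : ‖x - y‖ ≤ ‖clippedPower zs A x - clippedPower zs A y‖ +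
        ‖clippedPower zs A y - clippedPower zs (leaveOut j A) y‖ := by
      conv_lhs => rw [← hx, ← hy]
      exact norm_sub_le_norm_sub_add_norm_sub ..
    linarith
  have coord : ∀ u w : Vec n, ‖A u j‖ ≤ ‖A w j‖ + 1 / 10000 * ‖u - w‖ := by
    intro u w
    have h6 : ‖A (u - w) j‖ ≤ 1 / 10000 * ‖u - w‖ :=
      (PiLp.norm_apply_le _ _).trans (A.le_of_opNorm_le hA _)
    have h7 : A u j = A w j + A (u - w) j := by simp
    rw [h7]
    exact (norm_add_le _ _).trans (by gcongr)
  have h8 := coord x y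
  have h9 := coord y v
  have h10 := norm_iterate_clippedPower_sub_le hzs hA' hy k
  rw [← hv, norm_sub_rev] at h10
  linarith

/-! ### Coordinates with a weak local field -/

/-- The normalised data matrix `zs zsᴴ / n + A`, as an operator. -/
def dataOp (zs : Vec n) (A : Vec n →L[ℂ] Vec n) : Vec n →L[ℂ] Vec n :=
  ((n : ℂ)⁻¹ • (innerSL ℂ zs).smulRight zs) + A

lemma dataOp_apply (zs : Vec n) (A : Vec n →L[ℂ] Vec n) (x : Vec n) :
    dataOp zs A x = (inner ℂ zs x / n) • zs + A x := by
  simp [dataOp, smul_smul, div_eq_inv_mul]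

lemma dataOp_apply_coord (zs : Vec n) (A : Vec n →L[ℂ] Vec n) (x : Vec n) (j : Fin n) :
    dataOp zs A x j = inner ℂ zs x / n * zs j + A x j := by
  simp [dataOp_apply]

/-- The coordinates at which the local field of `z` is weak. -/
def weakCoords (zs : Vec n) (A : Vec n →L[ℂ] Vec n) (z : Vec n) : Finset (Fin n) :=
  {j | ‖dataOp zs A z j‖ < 1 / 20}

/-- The coordinates at which the noise acting on `x` exceeds `4 / 5`. -/
def noisyCoords (A : Vec n →L[ℂ] Vec n) (x : Vec n) : Finset (Fin n) :=
  {j | 4 / 5 < ‖A x j‖}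

/-- A phase vector `z` that is a fixed point of the power map is compared with the fixed point `x`
of the clipped power map. The two maps agree off the weak coordinates of `z`, hence `‖z - x‖²` is
of the order of their number, and at a weak coordinate either the noise acting on `x` is large or
`A (z - x)` is, which by the bound on `A` happens rarely. -/
lemma card_weakCoords_le {zs z x : Vec n} (hzs : ∀ j, ‖zs j‖ = 1) (hz : ∀ j, ‖z j‖ = 1)
    {A : Vec n →L[ℂ] Vec n} (hA : ‖A‖ ≤ 1 / 10000) {ρ : ℝ} (hρ : 9 / 10 ≤ ρ)
    (hov : inner ℂ zs z / n = ρ) (hfix : ∀ j, dataOp zs A z j = ‖dataOp zs A z j‖ * z j)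
    (hx : clippedPower zs A x = x) :
    (weakCoords zs A z).card ≤ 2 * (noisyCoords A x).card := by
  have hxP := mem_polydisc_of_clippedPower_eq_self hx
  have hover : overlap zs z = ρ := by
    have h1 : (inner ℂ zs z).re / n = ρ := by
      rw [← Complex.ofReal_re ρ, ← hov, Complex.div_natCast_re]
    rw [overlap, h1, max_eq_right hρ]
  have hT : ∀ j, clippedPower zs A z j = clip (dataOp zs A z j) := by
    intro j
    rw [clippedPower_apply, dataOp_apply_coord, hov, hover]
  have hdiff : ‖z - clippedPower zs A z‖ ^ 2 ≤ 4 * (weakCoords zs A z).card := by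
    rw [EuclideanSpace.norm_sq_eq]
    calc ∑ j, ‖(z - clippedPower zs A z) j‖ ^ 2
        ≤ ∑ j, if j ∈ weakCoords zs A z then (4 : ℝ) else 0 := by
          refine Finset.sum_le_sum fun j _ => ?_
          rw [PiLp.sub_apply, hT]
          split_ifs with hj
          · have h1 := norm_sub_le (z j) (clip (dataOp zs A z j))
            have h2 := norm_clip_le (dataOp zs A z j)
            rw [hz j] at h1
            nlinarith [norm_nonneg (z j - clip (dataOp zs A z j))]
          · have hj' : 1 / 20 ≤ ‖dataOp zs A z j‖ := by simpa [weakCoords] using hj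
            have h0 : (‖dataOp zs A z j‖ : ℂ) ≠ 0 := by
              have : (0 : ℝ) < ‖dataOp zs A z j‖ := by linarith
              exact_mod_cast this.ne'
            have h3 : clip (dataOp zs A z j) = z j := by
              rw [clip_of_le hj', div_eq_iff h0, mul_comm]
              exact hfix j
            simp [h3]
      _ = 4 * (weakCoords zs A z).card := by
          rw [Finset.sum_ite_mem, Finset.univ_inter, Finset.sum_const, nsmul_eq_mul, mul_comm]
  have hzx : ‖z - x‖ ≤ 2 * ‖z - clippedPower zs A z‖ := by
    have h1 := norm_clippedPower_sub_le hzs hA z hxP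
    rw [hx] at h1
    have h2 := norm_sub_le_norm_sub_add_norm_sub z (clippedPower zs A z) x
    linarith
  have hAzx : ‖A (z - x)‖ ≤ 1 / 10000 * ‖z - x‖ := A.le_of_opNorm_le hA _
  let K : Finset (Fin n) := {j | 1 / 20 < ‖A (z - x) j‖}
  have hsub : weakCoords zs A z ⊆ noisyCoords A x ∪ K := by
    intro j hj
    simp only [weakCoords, Finset.mem_filter, Finset.mem_univ, true_and] at hj
    simp only [noisyCoords, K, Finset.mem_union, Finset.mem_filter, Finset.mem_univ, true_and]
    by_contra! hcon
    rw [dataOp_apply_coord, hov] at hj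
    have h1 : A z j = A x j + A (z - x) j := by simp
    have h2 : ‖(ρ : ℂ) * zs j‖ = ρ := by
      rw [norm_mul, hzs j, Complex.norm_real, Real.norm_of_nonneg (by linarith), mul_one]
    have h3 := norm_sub_norm_le ((ρ : ℂ) * zs j) (-(A z j))
    rw [sub_neg_eq_add, norm_neg, h2] at h3
    have h4 : ‖A z j‖ ≤ ‖A x j‖ + ‖A (z - x) j‖ := h1 ▸ norm_add_le _ _
    linarith [hcon.1, hcon.2]
  have hK : (K.card : ℝ) * (1 / 400) ≤ ‖A (z - x)‖ ^ 2 := by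
    rw [EuclideanSpace.norm_sq_eq, ← nsmul_eq_mul, ← Finset.sum_const]
    refine (Finset.sum_le_sum fun j hj => ?_).trans
      (Finset.sum_le_sum_of_subset_of_nonneg (Finset.subset_univ K) fun j _ _ => sq_nonneg _)
    have : 1 / 20 < ‖A (z - x) j‖ := by simpa [K] using hj
    nlinarith
  have hcard : ((weakCoords zs A z).card : ℝ) ≤ (noisyCoords A x).card + K.card := by
    exact_mod_cast (Finset.card_le_card hsub).trans (Finset.card_union_le _ _)
  have h5 : ‖A (z - x)‖ ^ 2 ≤ (1 / 10000 * (2 * ‖z - clippedPower zs A z‖)) ^ 2 :=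
    pow_le_pow_left₀ (norm_nonneg _) (hAzx.trans (by gcongr)) 2
  have h6 : ((weakCoords zs A z).card : ℝ) ≤ 2 * (noisyCoords A x).card := by
    nlinarith
  exact_mod_cast h6

/-! ### Distance of a positive semidefinite competitor from a stationary phase vector -/

/-- The component of `u` orthogonal to the phase vector `z` (of squared norm `n`). -/
def residual (z u : Vec n) : Vec n := u - (inner ℂ z u / n) • z

lemma inner_residual (hn : 0 < n) {z : Vec n} (hz : ∀ j, ‖z j‖ = 1) (u : Vec n) :
    inner ℂ z (residual z u) = 0 := by
  have h : inner ℂ z z = (n : ℂ) := by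
    rw [inner_self_eq_norm_sq_to_K, ← Complex.ofReal_natCast,
      ← norm_sq_of_forall_norm_eq_one hz]
    norm_cast
  have hn' : (n : ℂ) ≠ 0 := by exact_mod_cast hn.ne'
  rw [residual, inner_sub_right, inner_smul_right, h]
  field_simp
  ring

lemma norm_sq_residual (hn : 0 < n) {z : Vec n} (hz : ∀ j, ‖z j‖ = 1) (u : Vec n) :
    n * ‖residual z u‖ ^ 2 = n * ‖u‖ ^ 2 - ‖inner ℂ z u‖ ^ 2 := by
  have hn' : (0 : ℝ) < n := by exact_mod_cast hn
  have h1 : u = residual z u + (inner ℂ z u / n) • z := by simp [residual]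
  have h2 : ‖u‖ ^ 2 = ‖residual z u‖ ^ 2 + ‖inner ℂ z u / n‖ ^ 2 * n := by
    have h3 : inner ℂ (residual z u) ((inner ℂ z u / n) • z) = 0 := by
      rw [inner_smul_right, ← inner_conj_symm (residual z u) z, inner_residual hn hz]
      simp
    conv_lhs => rw [h1]
    rw [← norm_sq_of_forall_norm_eq_one hz, ← mul_pow, ← norm_smul, sq, sq, sq]
    exact norm_add_sq_eq_norm_sq_add_norm_sq_of_inner_eq_zero _ _ h3
  rw [h2, norm_div, Complex.norm_natCast]
  field_simp
  ring

/-- The quadratic form of the dual certificate `diag g - dataOp zs A`. -/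
def certForm (g : Fin n → ℝ) (zs : Vec n) (A : Vec n →L[ℂ] Vec n) (u : Vec n) : ℝ :=
  ∑ j, g j * ‖u j‖ ^ 2 - (inner ℂ u (dataOp zs A u)).re

lemma isSymmetric_dataOp (zs : Vec n) {A : Vec n →L[ℂ] Vec n} (hA : A.IsSymmetric) :
    (dataOp zs A).IsSymmetric := by
  intro x y
  have h := hA x y
  simp only [ContinuousLinearMap.coe_coe] at h ⊢
  rw [dataOp_apply, dataOp_apply, inner_add_left, inner_add_right, h, inner_smul_left,
    inner_smul_right]
  congr 1
  rw [map_div₀, inner_conj_symm, Complex.conj_natCast]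
  ring

/-- The certificate annihilates `z`, so its quadratic form only sees the residual. -/
lemma certForm_residual {g : Fin n → ℝ} {zs z : Vec n} {A : Vec n →L[ℂ] Vec n}
    (hA : A.IsSymmetric) (hfix : ∀ j, dataOp zs A z j = g j * z j) (u : Vec n) :
    certForm g zs A (residual z u) = certForm g zs A u := by
  let D : Vec n →L[ℂ] Vec n := Matrix.toEuclideanCLM (𝕜 := ℂ) (Matrix.diagonal fun l => (g l : ℂ))
  have hD : ∀ v j, D v j = g j * v j := by
    intro v j
    simp [D, Matrix.mulVec_diagonal]
  have hDinner : ∀ v w : Vec n, inner ℂ v (D w) = ∑ j, (g j : ℂ) * inner ℂ (v j) (w j) := by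
    intro v w
    rw [PiLp.inner_apply]
    refine Finset.sum_congr rfl fun j _ => ?_
    rw [hD]
    simp
    ring
  have hDsymm : ∀ v w : Vec n, inner ℂ (D v) w = inner ℂ v (D w) := by
    intro v w
    rw [← inner_conj_symm, hDinner, hDinner, map_sum]
    refine Finset.sum_congr rfl fun j _ => ?_
    rw [map_mul, inner_conj_symm, Complex.conj_ofReal]
  have hcert : ∀ v, certForm g zs A v = (inner ℂ v (D v - dataOp zs A v)).re := by
    intro v
    rw [certForm, inner_sub_right, Complex.sub_re, hDinner, Complex.re_sum]
    congr 1
    refine Finset.sum_congr rfl fun j _ => ?_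
    rw [inner_self_eq_norm_sq_to_K, Complex.re_ofReal_mul]
    norm_cast
  have hLz : D z - dataOp zs A z = 0 := by
    ext j
    rw [PiLp.sub_apply, hD, hfix, sub_self]
    rfl
  have hLsymm : ∀ v, inner ℂ z (D v - dataOp zs A v) = 0 := by
    intro v
    have h := isSymmetric_dataOp zs hA z v
    simp only [ContinuousLinearMap.coe_coe] at h
    rw [inner_sub_right, ← hDsymm, ← h, ← inner_sub_left, hLz, inner_zero_left]
  have hL : ∀ c : ℂ, ∀ v, D (v - c • z) - dataOp zs A (v - c • z) = D v - dataOp zs A v := by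
    intro c v
    have : D (v - c • z) - dataOp zs A (v - c • z) =
        (D v - dataOp zs A v) - c • (D z - dataOp zs A z) := by
      simp only [map_sub, map_smul, smul_sub]
      abel
    rw [this, hLz, smul_zero, sub_zero]
  rw [hcert, hcert, residual, hL, inner_sub_left, inner_smul_left, hLsymm, mul_zero, sub_zero]

/-- On the orthogonal complement of a well correlated `z`, signal and noise together are too weak to
compensate a strong local field. -/
lemma le_certForm (hn : 0 < n) {g : Fin n → ℝ} {zs z : Vec n} (hzs : ∀ j, ‖zs j‖ = 1)
    (hz : ∀ j, ‖z j‖ = 1) {A : Vec n →L[ℂ] Vec n} (hA : ‖A‖ ≤ 1 / 10000) {ρ : ℝ}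
    (hρ : 1 - 1 / 1000 ≤ ρ) (hov : inner ℂ zs z / n = ρ) {r : Vec n} (hr : inner ℂ z r = 0) :
    ∑ j, g j * ‖r j‖ ^ 2 - 1 / 40 * ‖r‖ ^ 2 ≤ certForm g zs A r := by
  have hn' : (0 : ℝ) < n := by exact_mod_cast hn
  have hdist : ‖zs - z‖ ^ 2 ≤ 1 / 500 * n := by
    have h1 : (inner ℂ zs z).re = ρ * n := by
      have : inner ℂ zs z = ((ρ * n : ℝ) : ℂ) := by
        rw [div_eq_iff (by exact_mod_cast hn.ne')] at hov
        rw [hov]; push_cast; ring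
      rw [this, Complex.ofReal_re]
    have h2 := @norm_sub_sq ℂ _ _ _ _ zs z
    rw [norm_sq_of_forall_norm_eq_one hzs, norm_sq_of_forall_norm_eq_one hz] at h2
    simp only [RCLike.re_eq_complex_re, h1] at h2
    nlinarith
  have hinner : ‖inner ℂ zs r‖ ^ 2 ≤ 1 / 500 * n * ‖r‖ ^ 2 := by
    have h1 : inner ℂ zs r = inner ℂ (zs - z) r := by rw [inner_sub_left, hr, sub_zero]
    rw [h1]
    calc ‖inner ℂ (zs - z) r‖ ^ 2 ≤ (‖zs - z‖ * ‖r‖) ^ 2 :=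
          pow_le_pow_left₀ (norm_nonneg _) (norm_inner_le_norm _ _) 2
      _ = ‖zs - z‖ ^ 2 * ‖r‖ ^ 2 := mul_pow _ _ _
      _ ≤ _ := by gcongr
  have hnoise : (inner ℂ r (A r)).re ≤ 1 / 10000 * ‖r‖ ^ 2 := by
    calc (inner ℂ r (A r)).re ≤ ‖inner ℂ r (A r)‖ := Complex.re_le_norm _
      _ ≤ ‖r‖ * ‖A r‖ := norm_inner_le_norm _ _
      _ ≤ ‖r‖ * (1 / 10000 * ‖r‖) := by gcongr; exact A.le_of_opNorm_le hA _
      _ = _ := by ring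
  have hdata : (inner ℂ r (dataOp zs A r)).re = ‖inner ℂ zs r‖ ^ 2 / n + (inner ℂ r (A r)).re := by
    rw [dataOp_apply, inner_add_right, inner_smul_right, Complex.add_re]
    congr 1
    rw [← inner_conj_symm r zs, div_mul_eq_mul_div, Complex.mul_conj, Complex.normSq_eq_norm_sq]
    norm_cast
  have h3 : ‖inner ℂ zs r‖ ^ 2 / n ≤ 1 / 500 * ‖r‖ ^ 2 := by
    rw [div_le_iff₀ hn']
    linarith
  rw [certForm, hdata]
  nlinarith [sq_nonneg ‖r‖]

/-- A family of vectors whose Gram matrix has unit diagonal, and which does at least as well as `z`,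
is close to the line through `z`: the total residual is controlled by the number of weak
coordinates. -/
lemma sum_norm_sq_residual_le (hn : 0 < n) {zs z : Vec n} (hzs : ∀ j, ‖zs j‖ = 1)
    (hz : ∀ j, ‖z j‖ = 1) {A : Vec n →L[ℂ] Vec n} (hA : ‖A‖ ≤ 1 / 10000) (hsymm : A.IsSymmetric)
    {ρ : ℝ} (hρ : 1 - 1 / 1000 ≤ ρ) (hov : inner ℂ zs z / n = ρ)
    (hfix : ∀ j, dataOp zs A z j = ‖dataOp zs A z j‖ * z j)
    {m : ℕ} {u : Fin m → Vec n} (hu : ∀ j, ∑ i, ‖u i j‖ ^ 2 = 1)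
    (hcert : ∑ i, certForm (fun j => ‖dataOp zs A z j‖) zs A (u i) ≤ 0) :
    ∑ i, ‖residual z (u i)‖ ^ 2 ≤ 8 * (weakCoords zs A z).card := by
  have hn' : (0 : ℝ) < n := by exact_mod_cast hn
  set g : Fin n → ℝ := fun j => ‖dataOp zs A z j‖ with hg
  let R : Fin n → ℝ := fun j => ∑ i, ‖residual z (u i) j‖ ^ 2
  have hR0 : ∀ j, 0 ≤ R j := fun j => Finset.sum_nonneg fun i _ => sq_nonneg _
  have hRsum : ∑ i, ‖residual z (u i)‖ ^ 2 = ∑ j, R j := by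
    simp only [R, EuclideanSpace.norm_sq_eq]
    exact Finset.sum_comm
  have hgR : ∑ i, ∑ j, g j * ‖residual z (u i) j‖ ^ 2 = ∑ j, g j * R j := by
    rw [Finset.sum_comm]
    simp only [R, Finset.mul_sum]
  have hmain : ∑ j, g j * R j ≤ 1 / 40 * ∑ j, R j := by
    have h1 : ∑ i, (∑ j, g j * ‖residual z (u i) j‖ ^ 2 - 1 / 40 * ‖residual z (u i)‖ ^ 2) ≤ 0 := by
      refine (Finset.sum_le_sum fun i _ => ?_).trans hcert
      rw [← certForm_residual hsymm hfix (u i)]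
      exact le_certForm hn hzs hz hA hρ hov (inner_residual hn hz _)
    rw [Finset.sum_sub_distrib, ← Finset.mul_sum, hgR, hRsum] at h1
    linarith
  have hcoef : ∑ i, ‖inner ℂ z (u i) / n‖ ^ 2 ≤ 1 := by
    have h1 : ∑ i, ‖u i‖ ^ 2 = n := by
      simp only [EuclideanSpace.norm_sq_eq]
      rw [Finset.sum_comm]
      simp [hu]
    calc ∑ i, ‖inner ℂ z (u i) / n‖ ^ 2 ≤ ∑ i, ‖u i‖ ^ 2 / n := by
          refine Finset.sum_le_sum fun i _ => ?_
          have h2 := norm_sq_residual hn hz (u i)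
          rw [norm_div, Complex.norm_natCast, div_pow, div_le_div_iff₀ (by positivity) hn']
          nlinarith [mul_nonneg hn'.le (sq_nonneg ‖residual z (u i)‖),
            mul_nonneg (mul_nonneg hn'.le hn'.le) (sq_nonneg ‖residual z (u i)‖)]
      _ = 1 := by rw [← Finset.sum_div, h1, div_self hn'.ne']
  have hR4 : ∀ j, R j ≤ 4 := by
    intro j
    calc R j ≤ ∑ i, (2 * ‖u i j‖ ^ 2 + 2 * ‖inner ℂ z (u i) / n‖ ^ 2) := by
          refine Finset.sum_le_sum fun i _ => ?_
          have h1 : ‖residual z (u i) j‖ ≤ ‖u i j‖ + ‖inner ℂ z (u i) / n‖ := by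
            have h2 : residual z (u i) j = u i j - inner ℂ z (u i) / n * z j := by simp [residual]
            rw [h2]
            refine (norm_sub_le _ _).trans_eq ?_
            rw [norm_mul, hz j, mul_one]
          nlinarith [norm_nonneg (residual z (u i) j),
            sq_nonneg (‖u i j‖ - ‖inner ℂ z (u i) / n‖)]
      _ = 2 * ∑ i, ‖u i j‖ ^ 2 + 2 * ∑ i, ‖inner ℂ z (u i) / n‖ ^ 2 := by
          rw [Finset.sum_add_distrib, Finset.mul_sum, Finset.mul_sum]
      _ ≤ 4 := by rw [hu j]; linarith
  -- The strong coordinates pay `g j ≥ 1 / 20`, twice what the certificate inequality allows.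
  have hpoint : ∀ j, 1 / 20 * R j - g j * R j ≤ if j ∈ weakCoords zs A z then 1 / 5 else 0 := by
    intro j
    split_ifs with hj
    · have : 0 ≤ g j * R j := mul_nonneg (norm_nonneg _) (hR0 j)
      linarith [hR4 j]
    · have hj' : 1 / 20 ≤ g j := by simpa [weakCoords] using hj
      nlinarith [hR0 j]
  have hsum := Finset.sum_le_sum fun j (_ : j ∈ Finset.univ) => hpoint j
  rw [Finset.sum_sub_distrib, ← Finset.mul_sum, Finset.sum_ite_mem, Finset.univ_inter,
    Finset.sum_const, nsmul_eq_mul] at hsum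
  rw [hRsum]
  linarith

/-! ### Maximizers of the two programs -/

/-- The operator of a square matrix. -/
abbrev toOp (M : Matrix (Fin n) (Fin n) ℂ) : Vec n →L[ℂ] Vec n := Matrix.toEuclideanCLM (𝕜 := ℂ) M

lemma toOp_apply_coord (M : Matrix (Fin n) (Fin n) ℂ) (x : Vec n) (j : Fin n) :
    toOp M x j = ∑ k, M j k * x k := rfl

lemma isSymmetric_toOp {M : Matrix (Fin n) (Fin n) ℂ} (hM : M.IsHermitian) :
    (toOp M).IsSymmetric := by
  rw [Matrix.coe_toEuclideanCLM_eq_toEuclideanLin]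
  exact Matrix.isSymmetric_toEuclideanLin_iff.2 hM

lemma isHermitian_noiseMatrix (w : Fin n → Fin n → ℂ) : (noiseMatrix w).IsHermitian := by
  ext j k
  rcases lt_trichotomy j k with h | h | h
  · simp [noiseMatrix, h, h.not_gt]
  · subst h; simp [noiseMatrix]
  · simp [noiseMatrix, h, h.not_gt]

lemma isHermitian_outer (z : Fin n → ℂ) : (outer z).IsHermitian := by
  ext j k
  simp [outer, Matrix.vecMulVec_apply, mul_comm]

lemma isHermitian_observation (zs : Fin n → ℂ) (σ : ℝ) (w : Fin n → Fin n → ℂ) :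
    (observation zs σ w).IsHermitian := by
  refine (isHermitian_outer zs).add ?_
  rw [Matrix.IsHermitian, Matrix.conjTranspose_smul, (isHermitian_noiseMatrix w).eq]
  simp

/-- The noise operator, normalised by the strength `n` of the signal. -/
def noiseOp (σ : ℝ) (w : Fin n → Fin n → ℂ) : Vec n →L[ℂ] Vec n :=
  toOp (((σ / n : ℝ) : ℂ) • noiseMatrix w)

lemma isSymmetric_noiseOp (σ : ℝ) (w : Fin n → Fin n → ℂ) : (noiseOp σ w).IsSymmetric := by
  refine isSymmetric_toOp ?_
  rw [Matrix.IsHermitian, Matrix.conjTranspose_smul, (isHermitian_noiseMatrix w).eq]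
  simp

lemma toOp_observation (hn : 0 < n) (zs : Fin n → ℂ) (σ : ℝ) (w : Fin n → Fin n → ℂ) (x : Vec n) :
    toOp (observation zs σ w) x = (n : ℂ) • dataOp (WithLp.toLp 2 zs) (noiseOp σ w) x := by
  have hn' : (n : ℂ) ≠ 0 := by exact_mod_cast hn.ne'
  ext j
  rw [PiLp.smul_apply, dataOp_apply_coord, noiseOp, toOp_apply_coord, toOp_apply_coord, smul_eq_mul,
    mul_add, ← mul_assoc, mul_div_cancel₀ _ hn', PiLp.inner_apply, Finset.sum_mul, Finset.mul_sum,
    ← Finset.sum_add_distrib]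
  refine Finset.sum_congr rfl fun k _ => ?_
  simp only [observation, outer, Matrix.add_apply, Matrix.vecMulVec_apply, Matrix.smul_apply,
    Pi.star_apply, smul_eq_mul, RCLike.inner_apply, RCLike.star_def]
  push_cast
  field_simp

/-- For Hermitian `Y` the objective at a rank-one matrix is the quadratic form of `Y`. -/
lemma frobInner_outer {Y : Matrix (Fin n) (Fin n) ℂ} (hY : Y.IsHermitian) (u : Fin n → ℂ) :
    frobInner Y (outer u) = inner ℂ (WithLp.toLp 2 u : Vec n) (toOp Y (WithLp.toLp 2 u)) := by
  rw [frobInner, hY.eq, outer, Matrix.mul_vecMulVec, Matrix.trace_vecMulVec,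
    EuclideanSpace.inner_eq_star_dotProduct]
  rfl

lemma eq_norm_mul_of_norm_le_re {h p : ℂ} (hp : ‖p‖ = 1) (hle : ‖h‖ ≤ (star p * h).re) :
    h = ‖h‖ * p := by
  have h1 : ‖star p * h‖ = ‖h‖ := by rw [norm_mul, norm_star, hp, one_mul]
  have h2 : star p * h = (‖h‖ : ℂ) := by
    rw [← h1] at hle
    have h3 := Complex.re_le_norm (star p * h)
    have h4 : (star p * h).re = ‖star p * h‖ := le_antisymm h3 hle
    rw [← h1, ← h4]
    exact (Complex.re_eq_norm.1 h4).elim fun _ h6 => Complex.ext rfl (by simpa using h6.symm)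
  have h5 : p * star p = 1 := by
    rw [RCLike.star_def, Complex.mul_conj, Complex.normSq_eq_norm_sq, hp]; simp
  rw [← h2, mul_right_comm, mul_comm (star p), h5, one_mul]

/-- First-order optimality: a maximizer is a fixed point of the power method. Changing one
coordinate alters the objective by the linear term plus a nonnegative multiple of `Y j j`. -/
lemma IsMLE.toOp_apply_eq {Y : Matrix (Fin n) (Fin n) ℂ} (hY : Y.IsHermitian)
    (hdiag : ∀ j, Y j j = 1) {z : Fin n → ℂ} (hz : IsMLE Y z) (j : Fin n) :
    toOp Y (WithLp.toLp 2 z) j = ‖toOp Y (WithLp.toLp 2 z) j‖ * z j := by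
  set h := toOp Y (WithLp.toLp 2 z) j with hh
  refine eq_norm_mul_of_norm_le_re (hz.1 j) ?_
  have hstep : ∀ p : ℂ, ‖p‖ = 1 → (star p * h).re ≤ (star (z j) * h).re := by
    intro p hp
    have hmem : Function.update z j p ∈ phases n := by
      intro l
      by_cases hl : l = j
      · subst hl; simpa using hp
      · simpa [hl] using hz.1 l
    have hmax := hz.2 hmem
    have hupd : (WithLp.toLp 2 (Function.update z j p) : Vec n) =
        WithLp.toLp 2 z + EuclideanSpace.single j (p - z j) := by
      ext l
      by_cases hl : l = j
      · subst hl; simp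
      · simp [hl]
    have hsym := isSymmetric_toOp hY (WithLp.toLp 2 z) (EuclideanSpace.single j (p - z j))
    simp only [ContinuousLinearMap.coe_coe] at hsym
    have hquad : toOp Y (EuclideanSpace.single j (p - z j)) j = p - z j := by
      rw [toOp_apply_coord]
      simp [hdiag]
    simp only [Set.mem_ofPred_eq, frobInner_outer hY, hupd, map_add, inner_add_left,
      inner_add_right] at hmax
    rw [← hsym, EuclideanSpace.inner_single_left, EuclideanSpace.inner_single_left, hquad,
      EuclideanSpace.inner_single_right, ← hh] at hmax
    simp only [Complex.add_re, Complex.mul_re, Complex.sub_re, Complex.sub_im, Complex.conj_re,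
      Complex.conj_im, map_sub, RCLike.star_def] at hmax ⊢
    nlinarith [sq_nonneg (p.re - (z j).re), sq_nonneg (p.im - (z j).im)]
  by_cases h0 : h = 0
  · simp [h0]
  · have hn0 : ‖h‖ ≠ 0 := norm_ne_zero_iff.2 h0
    have h1 := hstep (h / ‖h‖) (by rw [norm_div, Complex.norm_real, norm_norm, div_self hn0])
    refine le_trans (le_of_eq ?_) h1
    have h2 : star (h / (‖h‖ : ℂ)) * h = ((‖h‖ : ℝ) : ℂ) := by
      have hc : (‖h‖ : ℂ) ≠ 0 := by exact_mod_cast hn0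
      rw [RCLike.star_def, map_div₀, Complex.conj_ofReal, div_mul_eq_mul_div, mul_comm,
        Complex.mul_conj, Complex.normSq_eq_norm_sq, div_eq_iff hc]
      push_cast; ring
    rw [h2, Complex.ofReal_re]

lemma outer_smul_of_norm_eq_one {c : ℂ} (hc : ‖c‖ = 1) (z : Fin n → ℂ) :
    outer (c • z) = outer z := by
  ext j k
  have : c * star c = 1 := by
    rw [RCLike.star_def, Complex.mul_conj, Complex.normSq_eq_norm_sq, hc]; simp
  simp only [outer, Matrix.vecMulVec_apply, Pi.smul_apply, Pi.star_apply, smul_eq_mul, star_mul']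
  linear_combination z j * star (z k) * this

/-- The global phase of a maximum likelihood estimate can be chosen such that its inner product with
the signal is a nonnegative real number. -/
lemma IsMLE.exists_aligned {Y : Matrix (Fin n) (Fin n) ℂ} {z : Fin n → ℂ} (hz : IsMLE Y z)
    (zs : Vec n) : ∃ z', IsMLE Y z' ∧ outer z' = outer z ∧
      ∃ ρ : ℝ, 0 ≤ ρ ∧ inner ℂ zs (WithLp.toLp 2 z' : Vec n) / n = ρ := by
  set s := inner ℂ zs (WithLp.toLp 2 z : Vec n) with hs
  obtain ⟨c, hc, hcs⟩ : ∃ c : ℂ, ‖c‖ = 1 ∧ c * s = ‖s‖ := by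
    by_cases h0 : s = 0
    · exact ⟨1, by simp, by simp [h0]⟩
    · have hn0 : ‖s‖ ≠ 0 := norm_ne_zero_iff.2 h0
      refine ⟨‖s‖ / s, ?_, div_mul_cancel₀ _ h0⟩
      rw [norm_div, Complex.norm_real, norm_norm, div_self hn0]
  refine ⟨c • z, ⟨fun j => ?_, fun v hv => ?_⟩, outer_smul_of_norm_eq_one hc z, ‖s‖ / n,
    by positivity, ?_⟩
  · rw [Pi.smul_apply, norm_smul, hc, hz.1 j, one_mul]
  · have := hz.2 hv
    simpa only [outer_smul_of_norm_eq_one hc z] using this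
  · rw [WithLp.toLp_smul, inner_smul_right, ← hs, hcs]
    push_cast; rfl

lemma observation_diag {zs : Fin n → ℂ} (hzs : zs ∈ phases n) (σ : ℝ) (w : Fin n → Fin n → ℂ)
    (j : Fin n) : observation zs σ w j j = 1 := by
  have : zs j * star (zs j) = 1 := by
    rw [RCLike.star_def, Complex.mul_conj, Complex.normSq_eq_norm_sq, hzs j]; simp
  simp [observation, outer, noiseMatrix, Matrix.vecMulVec_apply] at this ⊢
  exact this

/-- Small noise forces the estimate to correlate with the signal, since it does at least as well as
the signal itself. -/
lemma IsMLE.overlap_ge (hn : 0 < n) {zs : Fin n → ℂ} (hzs : zs ∈ phases n) {σ : ℝ}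
    {w : Fin n → Fin n → ℂ} (hA : ‖noiseOp σ w‖ ≤ 1 / 10000) {z : Fin n → ℂ}
    (hz : IsMLE (observation zs σ w) z) {ρ : ℝ} (hρ0 : 0 ≤ ρ)
    (hρ : inner ℂ (WithLp.toLp 2 zs : Vec n) (WithLp.toLp 2 z : Vec n) / n = ρ) :
    1 - 1 / 1000 ≤ ρ := by
  have hn' : (0 : ℝ) < n := by exact_mod_cast hn
  have hnc : (n : ℂ) ≠ 0 := by exact_mod_cast hn.ne'
  have hY := isHermitian_observation zs σ w
  have hobj : ∀ u : Fin n → ℂ, (frobInner (observation zs σ w) (outer u)).re =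
      ‖inner ℂ (WithLp.toLp 2 zs : Vec n) (WithLp.toLp 2 u : Vec n)‖ ^ 2 +
        n * (inner ℂ (WithLp.toLp 2 u : Vec n) (noiseOp σ w (WithLp.toLp 2 u))).re := by
    intro u
    rw [frobInner_outer hY, toOp_observation hn, dataOp_apply, inner_smul_right, inner_add_right,
      inner_smul_right, mul_add, Complex.add_re, ← mul_assoc, mul_div_cancel₀ _ hnc,
      ← inner_conj_symm (WithLp.toLp 2 u : Vec n) (WithLp.toLp 2 zs), Complex.mul_conj,
      Complex.normSq_eq_norm_sq, ← Complex.ofReal_natCast, Complex.re_ofReal_mul, Complex.ofReal_re]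
  have hnoise : ∀ u : Fin n → ℂ, u ∈ phases n →
      |(inner ℂ (WithLp.toLp 2 u : Vec n) (noiseOp σ w (WithLp.toLp 2 u))).re| ≤ 1 / 10000 * n := by
    intro u hu
    have hsq : ‖(WithLp.toLp 2 u : Vec n)‖ ^ 2 = n := norm_sq_of_forall_norm_eq_one hu
    calc _ ≤ ‖inner ℂ (WithLp.toLp 2 u : Vec n) (noiseOp σ w (WithLp.toLp 2 u))‖ :=
          Complex.abs_re_le_norm _
      _ ≤ ‖(WithLp.toLp 2 u : Vec n)‖ * ‖noiseOp σ w (WithLp.toLp 2 u)‖ := norm_inner_le_norm _ _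
      _ ≤ ‖(WithLp.toLp 2 u : Vec n)‖ * (1 / 10000 * ‖(WithLp.toLp 2 u : Vec n)‖) := by
          gcongr; exact ContinuousLinearMap.le_of_opNorm_le _ hA _
      _ = 1 / 10000 * ‖(WithLp.toLp 2 u : Vec n)‖ ^ 2 := by ring
      _ = 1 / 10000 * n := by rw [hsq]
  have hmax := hz.2 hzs
  simp only [Set.mem_ofPred_eq, hobj] at hmax
  have h1 : ‖inner ℂ (WithLp.toLp 2 zs : Vec n) (WithLp.toLp 2 z : Vec n)‖ = ρ * n := by
    rw [div_eq_iff hnc] at hρ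
    rw [hρ, norm_mul, Complex.norm_real, Real.norm_of_nonneg hρ0, Complex.norm_natCast]
  have h2 : ‖inner ℂ (WithLp.toLp 2 zs : Vec n) (WithLp.toLp 2 zs : Vec n)‖ = n := by
    rw [inner_self_eq_norm_sq_to_K, ← norm_sq_of_forall_norm_eq_one (z := WithLp.toLp 2 zs) hzs]
    simp
  have h3 := abs_le.1 (hnoise z hz.1)
  have h4 := abs_le.1 (hnoise zs hzs)
  rw [h1, h2] at hmax
  have h5 : (1 - 2 / 10000) * (n : ℝ) ^ 2 ≤ ρ ^ 2 * (n : ℝ) ^ 2 := by nlinarith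
  have h6 : 1 - 2 / 10000 ≤ ρ ^ 2 := le_of_mul_le_mul_right h5 (by positivity)
  nlinarith

lemma frobNorm_sq (M : Matrix (Fin n) (Fin n) ℂ) : frobNorm M ^ 2 = ∑ j, ∑ k, ‖M j k‖ ^ 2 :=
  Real.sq_sqrt (Finset.sum_nonneg fun _ _ => Finset.sum_nonneg fun _ _ => sq_nonneg _)

lemma eq_of_frobNorm_sub_sq_le_zero {M N : Matrix (Fin n) (Fin n) ℂ}
    (h : frobNorm (M - N) ^ 2 ≤ 0) : M = N := by
  rw [frobNorm_sq] at h
  have h0 := le_antisymm h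
    (Finset.sum_nonneg fun _ _ => Finset.sum_nonneg fun _ _ => sq_nonneg _)
  ext j k
  rw [Finset.sum_eq_zero_iff_of_nonneg
    fun _ _ => Finset.sum_nonneg fun _ _ => sq_nonneg _] at h0
  have h1 := h0 j (Finset.mem_univ j)
  rw [Finset.sum_eq_zero_iff_of_nonneg fun _ _ => sq_nonneg _] at h1
  have h2 := h1 k (Finset.mem_univ k)
  exact sub_eq_zero.1 (norm_eq_zero.1 (pow_eq_zero_iff two_ne_zero |>.1 h2))

lemma outer_mem_bmFeasible {m : ℕ} (hm : 1 ≤ m) {z : Fin n → ℂ} (hz : z ∈ phases n) :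
    outer z ∈ bmFeasible n m := by
  refine ⟨isHermitian_outer z, (Matrix.rank_vecMulVec_le _ _).trans hm,
    Matrix.posSemidef_vecMulVec_self_star z, fun j => ?_⟩
  rw [outer, Matrix.vecMulVec_apply, Pi.star_apply, RCLike.star_def, Complex.mul_conj,
    Complex.normSq_eq_norm_sq, hz j]
  simp

/-- Feasible matrices are Gram matrices of unit vectors. -/
lemma exists_gram_of_mem_bmFeasible {m : ℕ} {Z : Matrix (Fin n) (Fin n) ℂ}
    (hZ : Z ∈ bmFeasible n m) : ∃ (q : ℕ) (u : Fin q → Vec n),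
      Z = ∑ i, outer (u i).ofLp ∧ ∀ j, ∑ i, ‖u i j‖ ^ 2 = 1 := by
  obtain ⟨q, v, hv⟩ := Matrix.posSemidef_iff_eq_sum_vecMulVec.1 hZ.2.2.1
  refine ⟨q, fun i => WithLp.toLp 2 (v i), hv, fun j => ?_⟩
  have h := hZ.2.2.2 j
  rw [hv, Matrix.sum_apply] at h
  simp only [Matrix.vecMulVec_apply, Pi.star_apply, RCLike.star_def, Complex.mul_conj,
    Complex.normSq_eq_norm_sq] at h
  exact_mod_cast h

lemma norm_entry_le_one_of_gram {q : ℕ} {u : Fin q → Vec n} (hu : ∀ j, ∑ i, ‖u i j‖ ^ 2 = 1)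
    (j k : Fin n) : ‖(∑ i, outer (u i).ofLp : Matrix (Fin n) (Fin n) ℂ) j k‖ ≤ 1 := by
  rw [Matrix.sum_apply]
  calc ‖∑ i, outer (u i).ofLp j k‖ ≤ ∑ i, ‖outer (u i).ofLp j k‖ := norm_sum_le _ _
    _ ≤ ∑ i, (‖u i j‖ ^ 2 + ‖u i k‖ ^ 2) / 2 := by
        refine Finset.sum_le_sum fun i _ => ?_
        rw [outer, Matrix.vecMulVec_apply, Pi.star_apply, norm_mul, norm_star]
        nlinarith [sq_nonneg (‖u i j‖ - ‖u i k‖)]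
    _ = 1 := by
        rw [← Finset.sum_div, Finset.sum_add_distrib, hu, hu]; norm_num

lemma norm_entry_le_one {m : ℕ} {Z : Matrix (Fin n) (Fin n) ℂ} (hZ : Z ∈ bmFeasible n m)
    (j k : Fin n) : ‖Z j k‖ ≤ 1 := by
  obtain ⟨q, u, rfl, hu⟩ := exists_gram_of_mem_bmFeasible hZ
  exact norm_entry_le_one_of_gram hu j k

/-- The loss is at most four times its trivial scale, whatever the data. -/
lemma frobNorm_sub_outer_sq_le {m : ℕ} {Z : Matrix (Fin n) (Fin n) ℂ} (hZ : Z ∈ bmFeasible n m)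
    {z : Fin n → ℂ} (hz : z ∈ phases n) : frobNorm (Z - outer z) ^ 2 ≤ 4 * n ^ 2 := by
  rw [frobNorm_sq]
  calc ∑ j, ∑ k, ‖(Z - outer z) j k‖ ^ 2 ≤ ∑ _j : Fin n, ∑ _k : Fin n, (4 : ℝ) := by
        refine Finset.sum_le_sum fun j _ => Finset.sum_le_sum fun k _ => ?_
        have h1 := norm_sub_le (Z j k) (outer z j k)
        have h2 := norm_entry_le_one hZ j k
        have h3 : ‖outer z j k‖ = 1 := by
          rw [outer, Matrix.vecMulVec_apply, Pi.star_apply, norm_mul, norm_star, hz j, hz k,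
            one_mul]
        rw [Matrix.sub_apply]
        nlinarith [norm_nonneg (Z j k - outer z j k)]
    _ = 4 * n ^ 2 := by simp; ring

lemma frobNorm_gram_sub_outer_sq_le (hn : 0 < n) {q : ℕ} {u : Fin q → Vec n}
    (hu : ∀ j, ∑ i, ‖u i j‖ ^ 2 = 1) {z : Fin n → ℂ} (hz : z ∈ phases n) :
    frobNorm ((∑ i, outer (u i).ofLp) - outer z) ^ 2 ≤
      2 * n * ∑ i, ‖residual (WithLp.toLp 2 z) (u i)‖ ^ 2 := by
  set Z : Matrix (Fin n) (Fin n) ℂ := ∑ i, outer (u i).ofLp with hZ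
  have hform : ∑ j, ∑ k, (star (z j) * Z j k * z k).re =
      ∑ i, ‖inner ℂ (WithLp.toLp 2 z : Vec n) (u i)‖ ^ 2 := by
    have h1 : ∑ j, ∑ k, star (z j) * Z j k * z k =
        ∑ i, ((‖inner ℂ (WithLp.toLp 2 z : Vec n) (u i)‖ ^ 2 : ℝ) : ℂ) := by
      have h2 : ∀ i, ((‖inner ℂ (WithLp.toLp 2 z : Vec n) (u i)‖ ^ 2 : ℝ) : ℂ) =
          ∑ j, ∑ k, star (z j) * (u i j * star (u i k)) * z k := by
        intro i
        rw [← Complex.normSq_eq_norm_sq, ← Complex.mul_conj, PiLp.inner_apply, map_sum,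
          Finset.sum_mul_sum]
        refine Finset.sum_congr rfl fun j _ => Finset.sum_congr rfl fun k _ => ?_
        simp only [RCLike.inner_apply, map_mul, Complex.conj_conj, RCLike.star_def]
        ring
      simp only [h2]
      rw [Finset.sum_comm (s := Finset.univ (α := Fin q))]
      refine Finset.sum_congr rfl fun j _ => ?_
      rw [Finset.sum_comm (s := Finset.univ (α := Fin q))]
      refine Finset.sum_congr rfl fun k _ => ?_
      rw [hZ, Matrix.sum_apply, Finset.mul_sum, Finset.sum_mul]
      rfl
    have h3 := congrArg Complex.re h1
    simpa only [Complex.re_sum, Complex.ofReal_re] using h3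
  have hent : ∀ j k, ‖(Z - outer z) j k‖ ^ 2 ≤ 2 - 2 * (star (z j) * Z j k * z k).re := by
    intro j k
    have h1 : ‖outer z j k‖ = 1 := by
      rw [outer, Matrix.vecMulVec_apply, Pi.star_apply, norm_mul, norm_star, hz j, hz k, one_mul]
    have h2 := norm_entry_le_one_of_gram hu j k
    have h3 : ‖Z j k - outer z j k‖ ^ 2 =
        ‖Z j k‖ ^ 2 + ‖outer z j k‖ ^ 2 - 2 * (star (outer z j k) * Z j k).re := by
      simp only [← Complex.normSq_eq_norm_sq, Complex.normSq_apply, Complex.sub_re, Complex.sub_im,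
        Complex.mul_re, RCLike.star_def, Complex.conj_re, Complex.conj_im]
      ring
    have h4 : star (outer z j k) * Z j k = star (z j) * Z j k * z k := by
      simp only [outer, Matrix.vecMulVec_apply, Pi.star_apply, star_mul', star_star]
      ring
    rw [Matrix.sub_apply, h3, h4, h1]
    have h5 : ‖Z j k‖ ^ 2 ≤ 1 := pow_le_one₀ (norm_nonneg _) h2
    linarith
  have hres : (n : ℝ) * ∑ i, ‖residual (WithLp.toLp 2 z) (u i)‖ ^ 2 =
      n ^ 2 - ∑ i, ‖inner ℂ (WithLp.toLp 2 z : Vec n) (u i)‖ ^ 2 := by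
    have h1 : ∑ i, ‖u i‖ ^ 2 = n := by
      simp only [EuclideanSpace.norm_sq_eq]
      rw [Finset.sum_comm]
      simp [hu]
    rw [Finset.mul_sum, Finset.sum_congr rfl fun i _ =>
      norm_sq_residual hn (z := WithLp.toLp 2 z) hz (u i), Finset.sum_sub_distrib,
      ← Finset.mul_sum, h1, sq]
  calc frobNorm (Z - outer z) ^ 2
      ≤ ∑ j, ∑ k, (2 - 2 * (star (z j) * Z j k * z k).re) := by
        rw [frobNorm_sq]
        exact Finset.sum_le_sum fun j _ => Finset.sum_le_sum fun k _ => hent j k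
    _ = 2 * n ^ 2 - 2 * ∑ j, ∑ k, (star (z j) * Z j k * z k).re := by
        simp only [Finset.sum_sub_distrib, ← Finset.mul_sum]
        simp
        ring
    _ = 2 * n * ∑ i, ‖residual (WithLp.toLp 2 z) (u i)‖ ^ 2 := by
        rw [hform, mul_assoc, hres]; ring

/-- The deterministic heart of the argument: under small noise the loss is controlled by the number
of coordinates at which the noise acting on the fixed point of the clipped power map is large. -/
lemma frobNorm_sub_outer_sq_le_card (hn : 0 < n) {m : ℕ} (hm : 1 ≤ m) {zs : Fin n → ℂ}
    (hzs : zs ∈ phases n) {σ : ℝ} {w : Fin n → Fin n → ℂ} (hA : ‖noiseOp σ w‖ ≤ 1 / 10000)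
    {x : Vec n} (hx : clippedPower (WithLp.toLp 2 zs) (noiseOp σ w) x = x)
    {Z : Matrix (Fin n) (Fin n) ℂ} (hZ : IsBM m (observation zs σ w) Z) {z : Fin n → ℂ}
    (hz : IsMLE (observation zs σ w) z) :
    frobNorm (Z - outer z) ^ 2 ≤ 32 * n * (noisyCoords (noiseOp σ w) x).card := by
  have hn' : (0 : ℝ) < n := by exact_mod_cast hn
  have hY := isHermitian_observation zs σ w
  obtain ⟨z', hz', hout, ρ, hρ0, hρ⟩ := hz.exists_aligned (WithLp.toLp 2 zs)
  rw [← hout]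
  have hρ1 := hz'.overlap_ge hn hzs hA hρ0 hρ
  set V : Vec n := WithLp.toLp 2 z' with hV
  set A := noiseOp σ w with hAdef
  have hcoord : ∀ j, toOp (observation zs σ w) V j = n * dataOp (WithLp.toLp 2 zs) A V j := by
    intro j
    rw [toOp_observation hn]
    rfl
  have hfix : ∀ j, dataOp (WithLp.toLp 2 zs) A V j =
      ‖dataOp (WithLp.toLp 2 zs) A V j‖ * V j := by
    intro j
    have h1 := hz'.toOp_apply_eq hY (observation_diag hzs σ w) j
    rw [← hV, hcoord, norm_mul, Complex.norm_natCast] at h1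
    push_cast at h1
    rw [mul_assoc] at h1
    exact mul_left_cancel₀ (show (n : ℂ) ≠ 0 by exact_mod_cast hn.ne') h1
  obtain ⟨q, u, rfl, hu⟩ := exists_gram_of_mem_bmFeasible hZ.1
  -- The Burer-Monteiro solution does at least as well as the rank-one matrix of the estimate.
  have hcert : ∑ i, certForm (fun j => ‖dataOp (WithLp.toLp 2 zs) A V j‖) (WithLp.toLp 2 zs) A
      (u i) ≤ 0 := by
    have hmax := hZ.2 (outer_mem_bmFeasible hm hz'.1)
    have hobj : ∀ v : Vec n, (frobInner (observation zs σ w) (outer v.ofLp)).re =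
        n * (inner ℂ v (dataOp (WithLp.toLp 2 zs) A v)).re := by
      intro v
      rw [frobInner_outer hY, toOp_observation hn, inner_smul_right, ← Complex.ofReal_natCast,
        Complex.re_ofReal_mul]
    have hsum : (frobInner (observation zs σ w) (∑ i, outer (u i).ofLp)).re =
        n * ∑ i, (inner ℂ (u i) (dataOp (WithLp.toLp 2 zs) A (u i))).re := by
      rw [Finset.mul_sum, ← Finset.sum_congr rfl fun i _ => hobj (u i)]
      simp only [frobInner, Matrix.mul_sum, Matrix.trace_sum, Complex.re_sum]
    have hz'obj : (frobInner (observation zs σ w) (outer z')).re =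
        n * ∑ j, ‖dataOp (WithLp.toLp 2 zs) A V j‖ := by
      rw [show z' = V.ofLp from rfl, hobj, PiLp.inner_apply, Complex.re_sum]
      congr 1
      refine Finset.sum_congr rfl fun j _ => ?_
      have h1 : V j * star (V j) = 1 := by
        have : ‖V j‖ = 1 := hz'.1 j
        rw [RCLike.star_def, Complex.mul_conj, Complex.normSq_eq_norm_sq, this]; simp
      rw [RCLike.inner_apply]
      conv_lhs => rw [hfix j]
      rw [mul_assoc, ← RCLike.star_def, h1, mul_one, Complex.ofReal_re]
    simp only [Set.mem_ofPred_eq, hsum, hz'obj] at hmax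
    have hle := le_of_mul_le_mul_left hmax hn'
    simp only [certForm, Finset.sum_sub_distrib]
    rw [Finset.sum_comm]
    simp only [← Finset.mul_sum, hu, mul_one]
    linarith
  have h1 := sum_norm_sq_residual_le hn (zs := WithLp.toLp 2 zs) (z := V) hzs hz'.1 hA
    (isSymmetric_noiseOp σ w) hρ1 hρ hfix hu hcert
  have h2 := frobNorm_gram_sub_outer_sq_le hn hu hz'.1
  have h3 : ((weakCoords (WithLp.toLp 2 zs) A V).card : ℝ) ≤ 2 * (noisyCoords A x).card := by
    exact_mod_cast card_weakCoords_le (zs := WithLp.toLp 2 zs) (z := V) hzs hz'.1 hA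
      (by linarith) hρ hfix hx
  calc _ ≤ 2 * n * ∑ i, ‖residual V (u i)‖ ^ 2 := h2
    _ ≤ 2 * n * (8 * (2 * (noisyCoords A x).card)) := by gcongr; linarith
    _ = _ := by ring

/-! ### The noise as a Gaussian product measure -/

/-- The index set of the independent entries of the noise matrix. -/
abbrev Pairs (n : ℕ) := {p : Fin n × Fin n // p.1 < p.2}

/-- A family on pairs, as a strictly upper triangular array. -/
def upper (w : Pairs n → ℂ) (j k : Fin n) : ℂ := if h : j < k then w ⟨(j, k), h⟩ else 0

/-- The joint law of the independent entries of the noise matrix. -/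
def noiseLaw (n : ℕ) : Measure (Pairs n → ℂ) := Measure.pi fun _ => stdComplexGaussian

lemma measurable_realImag : Measurable fun p : ℝ × ℝ => (p.1 : ℂ) + (p.2 : ℂ) * Complex.I := by
  fun_prop

instance : IsProbabilityMeasure stdComplexGaussian :=
  Measure.isProbabilityMeasure_map measurable_realImag.aemeasurable

instance : IsProbabilityMeasure (noiseLaw n) := by
  unfold noiseLaw
  infer_instance

lemma noiseMatrix_upper (w : Fin n → Fin n → ℂ) :
    noiseMatrix (upper fun p => w p.1.1 p.1.2) = noiseMatrix w := by
  ext j k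
  rcases lt_trichotomy j k with h | h | h
  · simp [noiseMatrix, upper, h]
  · subst h; simp [noiseMatrix]
  · simp [noiseMatrix, upper, h, h.not_gt]

lemma IsNoise.aemeasurable {Ω : Type*} [MeasurableSpace Ω] {μ : Measure Ω}
    {ξ : Fin n → Fin n → Ω → ℂ} (hξ : IsNoise μ ξ) :
    AEMeasurable (fun ω (p : Pairs n) => ξ p.1.1 p.1.2 ω) μ :=
  aemeasurable_pi_lambda _ fun p => (hξ.law _ _ p.2).aemeasurable

lemma IsNoise.map_eq {Ω : Type*} [MeasurableSpace Ω] {μ : Measure Ω} [IsProbabilityMeasure μ]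
    {ξ : Fin n → Fin n → Ω → ℂ} (hξ : IsNoise μ ξ) :
    μ.map (fun ω (p : Pairs n) => ξ p.1.1 p.1.2 ω) = noiseLaw n := by
  rw [(iIndepFun_iff_map_fun_eq_pi_map fun p => (hξ.law _ _ p.2).aemeasurable).1 hξ.indep, noiseLaw]
  congr 1
  ext1 p
  exact (hξ.law _ _ p.2).map_eq

/-! ### Tail bounds for linear forms -/

lemma hasSubgaussianMGF_gaussianReal :
    HasSubgaussianMGF (fun x => x) (1 / 2) (gaussianReal 0 (1 / 2)) where
  integrable_exp_mul t := integrable_exp_mul_gaussianReal t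
  mgf_le t := by
    rw [mgf_fun_id_gaussianReal]
    simp

lemma hasSubgaussianMGF_stdComplexGaussian (c : ℂ) :
    HasSubgaussianMGF (fun x : ℂ => (c * x).re) (‖c‖₊ ^ 2 / 2) stdComplexGaussian := by
  let γ := gaussianReal 0 (1 / 2)
  have h1 : HasSubgaussianMGF (fun p : ℝ × ℝ => c.re * p.1) (NNReal.mk (c.re ^ 2) (sq_nonneg _) * (1 / 2))
      (γ.prod γ) := by
    have h := hasSubgaussianMGF_gaussianReal.const_mul c.re
    refine h.congr_identDistrib ⟨by fun_prop, by fun_prop, ?_⟩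
    rw [show (fun p : ℝ × ℝ => c.re * p.1) = (fun x => c.re * x) ∘ Prod.fst from rfl,
      ← Measure.map_map (by fun_prop) (by fun_prop), Measure.map_fst_prod]
    simp [γ]
  have h2 : HasSubgaussianMGF (fun p : ℝ × ℝ => -c.im * p.2) (NNReal.mk ((-c.im) ^ 2) (sq_nonneg _) * (1 / 2))
      (γ.prod γ) := by
    have h := hasSubgaussianMGF_gaussianReal.const_mul (-c.im)
    refine h.congr_identDistrib ⟨by fun_prop, by fun_prop, ?_⟩
    rw [show (fun p : ℝ × ℝ => -c.im * p.2) = (fun x => -c.im * x) ∘ Prod.snd from rfl,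
      ← Measure.map_map (by fun_prop) (by fun_prop), Measure.map_snd_prod]
    simp [γ]
  have hind : IndepFun (fun p : ℝ × ℝ => c.re * p.1) (fun p : ℝ × ℝ => -c.im * p.2) (γ.prod γ) :=
    indepFun_prod (X := fun x => c.re * x) (Y := fun x => -c.im * x) (by fun_prop) (by fun_prop)
  have h3 := h1.add_of_indepFun h2 hind
  have hc : NNReal.mk (c.re ^ 2) (sq_nonneg _) * (1 / 2) + NNReal.mk ((-c.im) ^ 2) (sq_nonneg _) * (1 / 2) =
      ‖c‖₊ ^ 2 / 2 := by
    ext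
    push_cast
    rw [← Complex.normSq_eq_norm_sq, Complex.normSq_apply]
    ring
  rw [hc] at h3
  refine h3.congr_identDistrib ⟨by fun_prop, by fun_prop, ?_⟩
  rw [stdComplexGaussian, Measure.map_map (by fun_prop) measurable_realImag]
  congr 1
  ext p
  simp
  ring

lemma noiseLaw_linear_ge_le (c : Pairs n → ℂ) {V t : ℝ} (ht : 0 ≤ t) (hV : 0 < V)
    (hc : ∑ p, ‖c p‖ ^ 2 ≤ V) :
    (noiseLaw n).real {w | t ≤ ∑ p, (c p * w p).re} ≤ Real.exp (-(t ^ 2 / V)) := by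
  have hind : iIndepFun (fun (p : Pairs n) (w : Pairs n → ℂ) => (c p * w p).re) (noiseLaw n) :=
    iIndepFun_pi (X := fun p x => (c p * x).re) fun p => by fun_prop
  have hsub : ∀ p ∈ Finset.univ, HasSubgaussianMGF (fun w : Pairs n → ℂ => (c p * w p).re)
      (‖c p‖₊ ^ 2 / 2) (noiseLaw n) := by
    intro p _
    refine (hasSubgaussianMGF_stdComplexGaussian (c p)).congr_identDistrib
      ⟨by fun_prop, by fun_prop, ?_⟩
    rw [show (fun w : Pairs n → ℂ => (c p * w p).re) =
      (fun x : ℂ => (c p * x).re) ∘ Function.eval p from rfl,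
      ← Measure.map_map (by fun_prop) (by fun_prop), noiseLaw,
      (measurePreserving_eval (fun _ : Pairs n => stdComplexGaussian) p).map_eq]
  have h := HasSubgaussianMGF.sum_of_iIndepFun hind hsub
  -- The variance proxy may be enlarged to `V / 2`, which is positive.
  have h' : HasSubgaussianMGF (fun w : Pairs n → ℂ => ∑ p, (c p * w p).re)
      (V / 2).toNNReal (noiseLaw n) := by
    refine ⟨h.integrable_exp_mul, fun s => (h.mgf_le s).trans ?_⟩
    refine Real.exp_le_exp.2 ?_
    gcongr
    rw [Real.le_toNNReal_iff_coe_le (by positivity)]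
    push_cast
    rw [← Finset.sum_div]
    gcongr
  refine (h'.measure_ge_le ht).trans_eq ?_
  congr 1
  rw [Real.coe_toNNReal _ (by positivity), mul_div_cancel₀ _ two_ne_zero, neg_div]

/-! ### Bilinear forms of the noise matrix -/

lemma sum_pairs {M : Type*} [AddCommMonoid M] (f : Fin n → Fin n → M) :
    ∑ p : Pairs n, f p.1.1 p.1.2 = ∑ j, ∑ k, if j < k then f j k else 0 := by
  rw [← Fintype.sum_prod_type' fun j k => if j < k then f j k else 0, ← Finset.sum_filter]
  exact (Finset.sum_subtype (Finset.univ.filter fun p : Fin n × Fin n => p.1 < p.2) (by simp)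
    fun p => f p.1 p.2).symm

/-- The coefficient of the entry with index `p` in the bilinear form of the noise matrix. -/
def bilinCoeff (x y : Vec n) (p : Pairs n) : ℂ :=
  star (x p.1.1) * y p.1.2 + x p.1.2 * star (y p.1.1)

lemma re_inner_noiseMatrix (x y : Vec n) (w : Pairs n → ℂ) :
    (inner ℂ x (toOp (noiseMatrix (upper w)) y)).re = ∑ p, (bilinCoeff x y p * w p).re := by
  have h1 : ∀ j k, (star (x j) * (noiseMatrix (upper w) j k * y k)).re =
      (if j < k then (star (x j) * upper w j k * y k).re else 0) +
      (if k < j then (star (y k) * upper w k j * x j).re else 0) := by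
    intro j k
    rcases lt_trichotomy j k with h | h | h
    · simp only [noiseMatrix, Matrix.of_apply, if_pos h, if_neg h.not_gt, add_zero, mul_assoc]
    · subst h; simp [noiseMatrix]
    · simp only [noiseMatrix, Matrix.of_apply, if_pos h, if_neg h.not_gt, zero_add]
      rw [← Complex.conj_re]
      congr 1
      simp only [map_mul, RCLike.star_def, Complex.conj_conj]
      ring
  have h2 : (inner ℂ x (toOp (noiseMatrix (upper w)) y)).re =
      ∑ j, ∑ k, (star (x j) * (noiseMatrix (upper w) j k * y k)).re := by
    rw [PiLp.inner_apply, Complex.re_sum]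
    refine Finset.sum_congr rfl fun j _ => ?_
    rw [RCLike.inner_apply, toOp_apply_coord, Finset.sum_mul, Complex.re_sum]
    refine Finset.sum_congr rfl fun k _ => ?_
    rw [RCLike.star_def, mul_comm]
  have h3 : ∀ p : Pairs n, (bilinCoeff x y p * w p).re =
      (star (x p.1.1) * upper w p.1.1 p.1.2 * y p.1.2).re +
        (star (y p.1.1) * upper w p.1.1 p.1.2 * x p.1.2).re := by
    intro p
    have : upper w p.1.1 p.1.2 = w p := by simp [upper, p.2]
    rw [this, ← Complex.add_re, bilinCoeff]
    congr 1
    ring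
  rw [h2, Finset.sum_congr rfl fun p _ => h3 p, Finset.sum_add_distrib,
    sum_pairs fun j k => (star (x j) * upper w j k * y k).re,
    sum_pairs fun j k => (star (y j) * upper w j k * x k).re]
  simp only [h1, Finset.sum_add_distrib]
  congr 1
  exact Finset.sum_comm

lemma sum_pairs_add_swap_le {g : Fin n → Fin n → ℝ} (hg : ∀ j k, 0 ≤ g j k) :
    ∑ p : Pairs n, (g p.1.1 p.1.2 + g p.1.2 p.1.1) ≤ ∑ j, ∑ k, g j k := by
  rw [Finset.sum_add_distrib, sum_pairs g, sum_pairs fun j k => g k j,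
    Finset.sum_comm (f := fun j k => if j < k then g k j else 0), ← Finset.sum_add_distrib]
  refine Finset.sum_le_sum fun j _ => ?_
  rw [← Finset.sum_add_distrib]
  refine Finset.sum_le_sum fun k _ => ?_
  rcases lt_trichotomy j k with h | h | h
  · simp [h, h.not_gt]
  · subst h; simpa using hg j j
  · simp [h, h.not_gt]

lemma sum_sum_norm_sq_mul (x y : Vec n) :
    ∑ j, ∑ k, ‖x j‖ ^ 2 * ‖y k‖ ^ 2 = ‖x‖ ^ 2 * ‖y‖ ^ 2 := by
  rw [EuclideanSpace.norm_sq_eq, EuclideanSpace.norm_sq_eq, Finset.sum_mul_sum]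

lemma sum_norm_bilinCoeff_sq_le (x y : Vec n) :
    ∑ p, ‖bilinCoeff x y p‖ ^ 2 ≤ 2 * (‖x‖ ^ 2 * ‖y‖ ^ 2) := by
  rw [← sum_sum_norm_sq_mul]
  refine le_trans ?_ (mul_le_mul_of_nonneg_left (sum_pairs_add_swap_le
    (g := fun j k => ‖x j‖ ^ 2 * ‖y k‖ ^ 2) fun _ _ => by positivity) zero_le_two)
  rw [Finset.mul_sum]
  refine Finset.sum_le_sum fun p _ => ?_
  have h : ‖bilinCoeff x y p‖ ≤ ‖x p.1.1‖ * ‖y p.1.2‖ + ‖x p.1.2‖ * ‖y p.1.1‖ := by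
    refine (norm_add_le _ _).trans_eq ?_
    simp
  nlinarith [norm_nonneg (bilinCoeff x y p),
    sq_nonneg (‖x p.1.1‖ * ‖y p.1.2‖ - ‖x p.1.2‖ * ‖y p.1.1‖)]

/-- For a vector supported at one coordinate the two terms of each coefficient do not interfere. -/
lemma sum_norm_bilinCoeff_single_sq_le (j : Fin n) {c : ℂ} (hc : ‖c‖ = 1) (y : Vec n) :
    ∑ p, ‖bilinCoeff (EuclideanSpace.single j c) y p‖ ^ 2 ≤ ‖y‖ ^ 2 := by
  have h := sum_pairs_add_swap_le (g := fun a b => ‖(EuclideanSpace.single j c : Vec n) a‖ ^ 2 *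
    ‖y b‖ ^ 2) fun _ _ => by positivity
  rw [sum_sum_norm_sq_mul, PiLp.norm_single, hc, one_pow, one_mul] at h
  refine (Finset.sum_le_sum fun p _ => ?_).trans h
  have hp := p.2
  by_cases h1 : p.1.1 = j
  · have h2 : p.1.2 ≠ j := fun h2 => by rw [h1, h2] at hp; exact lt_irrefl _ hp
    simp [bilinCoeff, h1, h2, hc]
  · by_cases h2 : p.1.2 = j
    · simp [bilinCoeff, h1, h2, hc]
    · simp [bilinCoeff, h1, h2]

/-! ### The operator norm of the noise matrix -/

/-- A `1 / 2`-net of the unit sphere of `Vec n`, from a maximal separated set. -/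
lemma exists_net (n : ℕ) : ∃ N : Finset (Vec n), N.card ≤ 5 ^ (2 * n) ∧ (∀ x ∈ N, ‖x‖ ≤ 1) ∧
    ∀ v : Vec n, ‖v‖ = 1 → ∃ x ∈ N, ‖v - x‖ ≤ 1 / 2 := by
  classical
  let B : Set (Vec n) := Metric.closedBall 0 2
  have hfr : Module.finrank ℝ (Vec n) = 2 * n := by
    rw [finrank_real_of_complex]; simp
  have hcard : ∀ C : Set (Vec n), C ⊆ B → Metric.IsSeparated (1 : NNReal) C →
      C.encard ≤ (5 ^ (2 * n) : ℕ) := by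
    intro C hC hsep
    by_contra! hlt
    obtain ⟨D, hDC, hD⟩ := Set.exists_subset_encard_eq (Order.add_one_le_of_lt hlt)
    have hfin : D.Finite := Set.finite_of_encard_eq_coe (k := 5 ^ (2 * n) + 1) (by simpa using hD)
    have h1 := Besicovitch.card_le_of_separated hfin.toFinset
      (fun c hc => by simpa [B] using hC (hDC (hfin.mem_toFinset.1 hc)))
      (fun c hc d hd hcd => by
        have h : (1 : ENNReal) < edist c d := by
          simpa using hsep (hDC (hfin.mem_toFinset.1 hc)) (hDC (hfin.mem_toFinset.1 hd)) hcd
        rw [edist_dist, dist_eq_norm, ENNReal.one_lt_ofReal] at h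
        exact h.le)
    rw [hfr] at h1
    rw [hfin.encard_eq_coe_toFinset_card] at hD
    have h2 : hfin.toFinset.card = 5 ^ (2 * n) + 1 := by exact_mod_cast hD
    omega
  have hpack : Metric.packingNumber 1 B ≤ (5 ^ (2 * n) : ℕ) :=
    iSup_le fun C => iSup_le fun hC => iSup_le fun hsep => hcard C hC hsep
  have hne : Metric.packingNumber 1 B ≠ ⊤ := (hpack.trans_lt (ENat.natCast_lt_top _)).ne
  have hcov := Metric.isCover_maximalSeparatedSet hne
  have hMcard : (Metric.maximalSeparatedSet 1 B).encard ≤ (5 ^ (2 * n) : ℕ) :=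
    (Metric.encard_maximalSeparatedSet hne).trans_le hpack
  have hfin : (Metric.maximalSeparatedSet 1 B).Finite := Set.finite_of_encard_le_coe hMcard
  refine ⟨hfin.toFinset.image fun x => (1 / 2 : ℝ) • x, ?_, ?_, ?_⟩
  · refine Finset.card_image_le.trans ?_
    rw [hfin.encard_eq_coe_toFinset_card] at hMcard
    exact_mod_cast hMcard
  · intro x hx
    obtain ⟨y, hy, rfl⟩ := Finset.mem_image.1 hx
    have h1 : ‖y‖ ≤ 2 := by
      simpa [B] using Metric.maximalSeparatedSet_subset (hfin.mem_toFinset.1 hy)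
    rw [norm_smul]
    norm_num
    linarith
  · intro v hv
    have hvB : (2 : ℝ) • v ∈ B := by simp [B, norm_smul, hv]
    obtain ⟨y, hy, hvy⟩ := hcov hvB
    refine ⟨(1 / 2 : ℝ) • y, Finset.mem_image_of_mem _ (hfin.mem_toFinset.2 hy), ?_⟩
    have h1 : ‖(2 : ℝ) • v - y‖ ≤ 1 := by
      have h2 : edist ((2 : ℝ) • v) y ≤ 1 := by simpa using hvy
      rw [edist_dist, dist_eq_norm, ← ENNReal.ofReal_one] at h2
      exact (ENNReal.ofReal_le_ofReal_iff zero_le_one).1 h2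
    have h3 : v - (1 / 2 : ℝ) • y = (1 / 2 : ℝ) • ((2 : ℝ) • v - y) := by
      rw [smul_sub, smul_smul]; norm_num
    rw [h3, norm_smul]
    norm_num
    linarith

/-- The operator norm is controlled by the bilinear form on a net. -/
lemma opNorm_le_of_net {N : Finset (Vec n)}
    (hnet : ∀ v : Vec n, ‖v‖ = 1 → ∃ x ∈ N, ‖v - x‖ ≤ 1 / 2) {t : ℝ} (ht : 0 ≤ t)
    {T : Vec n →L[ℂ] Vec n} (hT : ∀ x ∈ N, ∀ y ∈ N, (inner ℂ x (T y)).re ≤ t) :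
    ‖T‖ ≤ 4 * t := by
  have hvec : ∀ v : Vec n, (∀ x ∈ N, (inner ℂ x v).re ≤ t) → ‖v‖ ≤ 2 * t := by
    intro v hv
    by_cases h0 : v = 0
    · simp [h0, ht]
    have hn0 : ‖v‖ ≠ 0 := norm_ne_zero_iff.2 h0
    have hc : (‖v‖ : ℂ) ≠ 0 := by exact_mod_cast hn0
    set e : Vec n := ((‖v‖ : ℂ)⁻¹) • v with he
    have he1 : ‖e‖ = 1 := by
      rw [he, norm_smul, norm_inv, Complex.norm_real, norm_norm, inv_mul_cancel₀ hn0]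
    obtain ⟨x, hx, hex⟩ := hnet e he1
    have h1 : inner ℂ e v = (‖v‖ : ℂ) := by
      rw [he, inner_smul_left, inner_self_eq_norm_sq_to_K, map_inv₀, Complex.conj_ofReal]
      simp only [Complex.coe_algebraMap]
      field_simp
    have h2 : (inner ℂ (e - x) v).re ≤ 1 / 2 * ‖v‖ := by
      refine (Complex.re_le_norm _).trans ((norm_inner_le_norm _ _).trans ?_)
      gcongr
    have h3 : (inner ℂ (e - x) v).re = ‖v‖ - (inner ℂ x v).re := by
      rw [inner_sub_left, h1, Complex.sub_re, Complex.ofReal_re]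
    have h4 := hv x hx
    linarith
  have hnetT : ∀ y ∈ N, ‖T y‖ ≤ 2 * t := fun y hy => hvec _ fun x hx => hT x hx y hy
  have hbound : ‖T‖ ≤ 2 * t + ‖T‖ / 2 := by
    refine ContinuousLinearMap.opNorm_le_of_unit_norm (𝕜 := ℂ) (by positivity) fun v hv => ?_
    obtain ⟨y, hy, hvy⟩ := hnet v hv
    have h1 : T v = T y + T (v - y) := by rw [map_sub]; abel
    rw [h1]
    refine (norm_add_le _ _).trans (add_le_add (hnetT y hy) ?_)
    refine (T.le_opNorm _).trans ?_
    have := mul_le_mul_of_nonneg_left hvy (norm_nonneg T)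
    linarith
  linarith

/-- The operator norm of the noise matrix exceeds `24 √n` with exponentially small probability. -/
lemma noiseLaw_opNorm_gt_le (n : ℕ) :
    (noiseLaw n).real {w | 24 * √n < ‖toOp (noiseMatrix (upper w))‖} ≤ Real.exp (-(11 * n)) := by
  obtain ⟨N, hcard, hN1, hnet⟩ := exists_net n
  have hsub : {w | 24 * √n < ‖toOp (noiseMatrix (upper w))‖} ⊆
      ⋃ q ∈ N ×ˢ N, {w | 6 * √n ≤ ∑ p, (bilinCoeff q.1 q.2 p * w p).re} := by
    intro w hw
    by_contra hcon
    simp only [Set.mem_iUnion, not_exists, Set.mem_ofPred_eq, not_le] at hcon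
    have h1 : ‖toOp (noiseMatrix (upper w))‖ ≤ 4 * (6 * √n) := by
      refine opNorm_le_of_net hnet (by positivity) fun x hx y hy => ?_
      rw [re_inner_noiseMatrix]
      exact (hcon (x, y) (Finset.mk_mem_product hx hy)).le
    rw [Set.mem_ofPred_eq] at hw
    linarith
  calc (noiseLaw n).real {w | 24 * √n < ‖toOp (noiseMatrix (upper w))‖}
      ≤ (noiseLaw n).real
          (⋃ q ∈ N ×ˢ N, {w | 6 * √n ≤ ∑ p, (bilinCoeff q.1 q.2 p * w p).re}) :=
        measureReal_mono hsub (measure_ne_top _ _)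
    _ ≤ ∑ q ∈ N ×ˢ N, (noiseLaw n).real {w | 6 * √n ≤ ∑ p, (bilinCoeff q.1 q.2 p * w p).re} :=
        measureReal_biUnion_finset_le _ _
    _ ≤ ∑ _q ∈ N ×ˢ N, Real.exp (-(18 * n)) := by
        refine Finset.sum_le_sum fun q hq => ?_
        obtain ⟨h1, h2⟩ := Finset.mem_product.1 hq
        have hx : ‖q.1‖ ^ 2 ≤ 1 := pow_le_one₀ (norm_nonneg _) (hN1 _ h1)
        have hy : ‖q.2‖ ^ 2 ≤ 1 := pow_le_one₀ (norm_nonneg _) (hN1 _ h2)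
        refine (noiseLaw_linear_ge_le (bilinCoeff q.1 q.2) (by positivity) two_pos ?_).trans_eq ?_
        · have := sum_norm_bilinCoeff_sq_le q.1 q.2
          nlinarith [sq_nonneg ‖q.1‖, sq_nonneg ‖q.2‖]
        · rw [mul_pow, Real.sq_sqrt (Nat.cast_nonneg n)]
          congr 1
          ring
    _ = (N.card : ℝ) ^ 2 * Real.exp (-(18 * n)) := by
        rw [Finset.sum_const, Finset.card_product, nsmul_eq_mul]
        push_cast
        ring
    _ ≤ Real.exp 7 ^ n * Real.exp (-(18 * n)) := by
        gcongr
        have h625 : (625 : ℝ) ≤ Real.exp 7 := by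
          have h1 : (2.7 : ℝ) ≤ Real.exp 1 := by linarith [Real.exp_one_gt_d9]
          have h2 : Real.exp 7 = Real.exp 1 ^ 7 := by rw [← Real.exp_nat_mul]; norm_num
          rw [h2]
          exact le_trans (by norm_num) (pow_le_pow_left₀ (by norm_num) h1 7)
        calc (N.card : ℝ) ^ 2 ≤ ((5 : ℝ) ^ (2 * n)) ^ 2 := by
              gcongr
              exact_mod_cast hcard
          _ = 625 ^ n := by rw [← pow_mul, mul_right_comm, pow_mul]; norm_num
          _ ≤ Real.exp 7 ^ n := by gcongr
    _ = Real.exp (-(11 * n)) := by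
        rw [← Real.exp_nat_mul, ← Real.exp_add]
        congr 1
        ring

/-! ### Large noise at the leave-one-out iterates -/

/-- A coordinate of the noise matrix applied to a fixed vector has a Gaussian tail. The modulus is
bounded through its real part in the four directions `±1`, `±I`. -/
lemma noiseLaw_norm_apply_gt_le (hn : 0 < n) {y : Vec n} (hy : y ∈ polydisc n) (j : Fin n) {s : ℝ}
    (hs : 0 ≤ s) :
    (noiseLaw n).real {w | s < ‖toOp (noiseMatrix (upper w)) y j‖} ≤
      4 * Real.exp (-(s ^ 2 / (2 * n))) := by
  have hn' : (0 : ℝ) < n := by exact_mod_cast hn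
  have hdir : ∀ c : ℂ, ‖c‖ = 1 → (noiseLaw n).real
      {w | s / √2 ≤ (star c * toOp (noiseMatrix (upper w)) y j).re} ≤
        Real.exp (-(s ^ 2 / (2 * n))) := by
    intro c hc
    have h1 : {w | s / √2 ≤ (star c * toOp (noiseMatrix (upper w)) y j).re} =
        {w | s / √2 ≤ ∑ p, (bilinCoeff (EuclideanSpace.single j c) y p * w p).re} := by
      ext w
      rw [Set.mem_ofPred_eq, Set.mem_ofPred_eq, ← re_inner_noiseMatrix,
        EuclideanSpace.inner_single_left, RCLike.star_def]
    rw [h1]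
    refine (noiseLaw_linear_ge_le _ (by positivity) hn'
      ((sum_norm_bilinCoeff_single_sq_le j hc y).trans (norm_sq_le_of_mem_polydisc hy))).trans_eq ?_
    rw [div_pow, Real.sq_sqrt zero_le_two, div_div]
  have hsub : {w | s < ‖toOp (noiseMatrix (upper w)) y j‖} ⊆
      ⋃ c ∈ ({1, -1, Complex.I, -Complex.I} : Finset ℂ),
        {w | s / √2 ≤ (star c * toOp (noiseMatrix (upper w)) y j).re} := by
    intro w hw
    rw [Set.mem_ofPred_eq] at hw
    by_contra hcon
    simp only [Finset.mem_insert, Finset.mem_singleton, Set.iUnion_iUnion_eq_or_left,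
      Set.iUnion_iUnion_eq_left, Set.mem_union, Set.mem_ofPred_eq, not_or, not_le] at hcon
    generalize toOp (noiseMatrix (upper w)) y j = v at hw hcon
    obtain ⟨h1, h2, h3, h4⟩ := hcon
    have h1' : v.re < s / √2 := by simpa using h1
    have h2' : -v.re < s / √2 := by simpa using h2
    have h3' : v.im < s / √2 := by simpa using h3
    have h4' : -v.im < s / √2 := by simpa using h4
    have hsq : (s / √2) ^ 2 = s ^ 2 / 2 := by rw [div_pow, Real.sq_sqrt zero_le_two]
    have h5 : ‖v‖ ^ 2 ≤ s ^ 2 := by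
      rw [← Complex.normSq_eq_norm_sq, Complex.normSq_apply]
      nlinarith
    have h6 : ‖v‖ ≤ s := (pow_le_pow_iff_left₀ (norm_nonneg _) hs two_ne_zero).1 h5
    linarith
  calc (noiseLaw n).real {w | s < ‖toOp (noiseMatrix (upper w)) y j‖}
      ≤ ∑ c ∈ ({1, -1, Complex.I, -Complex.I} : Finset ℂ), (noiseLaw n).real
          {w | s / √2 ≤ (star c * toOp (noiseMatrix (upper w)) y j).re} :=
        (measureReal_mono hsub (measure_ne_top _ _)).trans (measureReal_biUnion_finset_le _ _)
    _ ≤ ∑ _c ∈ ({1, -1, Complex.I, -Complex.I} : Finset ℂ), Real.exp (-(s ^ 2 / (2 * n))) := by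
        refine Finset.sum_le_sum fun c hc => hdir c ?_
        simp only [Finset.mem_insert, Finset.mem_singleton] at hc
        rcases hc with rfl | rfl | rfl | rfl <;> simp
    _ ≤ 4 * Real.exp (-(s ^ 2 / (2 * n))) := by
        rw [Finset.sum_const, nsmul_eq_mul]
        gcongr
        exact_mod_cast Finset.card_le_four

/-- Resampling: in a product of probability measures, coordinates may be drawn from two independent
copies without changing the law. -/
lemma map_merge_pi {ι α : Type*} [Fintype ι] [MeasurableSpace α] (ν : Measure α)
    [IsProbabilityMeasure ν] (S : ι → Prop) [DecidablePred S] :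
    ((Measure.pi fun _ : ι => ν).prod (Measure.pi fun _ : ι => ν)).map
      (fun q i => if S i then q.1 i else q.2 i) = Measure.pi fun _ : ι => ν := by
  have hmeas : Measurable fun (q : (ι → α) × (ι → α)) i => if S i then q.1 i else q.2 i := by
    refine measurable_pi_lambda _ fun i => ?_
    split_ifs <;> fun_prop
  refine (Measure.pi_eq fun s hs => ?_).symm
  rw [Measure.map_apply hmeas (MeasurableSet.univ_pi hs)]
  have hpre : (fun (q : (ι → α) × (ι → α)) i => if S i then q.1 i else q.2 i) ⁻¹' Set.univ.pi s =
      (Set.univ.pi fun i => if S i then s i else Set.univ) ×ˢ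
        (Set.univ.pi fun i => if S i then Set.univ else s i) := by
    ext q
    simp only [Set.mem_preimage, Set.mem_pi, Set.mem_univ, true_imp_iff, Set.mem_prod,
      ← forall_and]
    refine forall_congr' fun i => ?_
    split_ifs <;> simp
  rw [hpre, Measure.prod_prod, Measure.pi_pi, Measure.pi_pi, ← Finset.prod_mul_distrib]
  refine Finset.prod_congr rfl fun i _ => ?_
  split_ifs <;> simp

/-- If an event depends on `w` through the coordinates in `S` in its first argument and through the
others in its second, then the second argument may be treated as a constant. -/
lemma pi_measure_le_of_forall_le {ι α : Type*} [Fintype ι] [MeasurableSpace α] (ν : Measure α)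
    [IsProbabilityMeasure ν] (S : ι → Prop) [DecidablePred S] {G : Set ((ι → α) × (ι → α))}
    (hG : MeasurableSet G)
    (hdep : ∀ w w' : ι → α, ((fun i => if S i then w i else w' i),
      (fun i => if S i then w i else w' i)) ∈ G ↔ (w, w') ∈ G) {K : ENNReal}
    (hK : ∀ w', (Measure.pi fun _ : ι => ν) {w | (w, w') ∈ G} ≤ K) :
    (Measure.pi fun _ : ι => ν) {w | (w, w) ∈ G} ≤ K := by
  have hmeas : Measurable fun (q : (ι → α) × (ι → α)) i => if S i then q.1 i else q.2 i := by
    refine measurable_pi_lambda _ fun i => ?_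
    split_ifs <;> fun_prop
  have hdiag : MeasurableSet {w : ι → α | (w, w) ∈ G} :=
    hG.preimage (f := fun w : ι → α => (w, w)) (by fun_prop)
  conv_lhs => rw [← map_merge_pi ν S]
  rw [Measure.map_apply hmeas hdiag]
  have hpre : (fun (q : (ι → α) × (ι → α)) i => if S i then q.1 i else q.2 i) ⁻¹'
      {w : ι → α | (w, w) ∈ G} = G := by
    ext ⟨w, w'⟩
    exact hdep w w'
  rw [hpre, Measure.prod_apply_symm hG]
  calc _ ≤ ∫⁻ _, K ∂(Measure.pi fun _ : ι => ν) := lintegral_mono fun w' => hK w'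
    _ = K := by simp

lemma continuous_toOp : Continuous fun M : Matrix (Fin n) (Fin n) ℂ => toOp M :=
  (Matrix.toEuclideanCLM (n := Fin n)
    (𝕜 := ℂ)).toAlgEquiv.toLinearMap.continuous_of_finiteDimensional

lemma continuous_noiseMatrix_upper :
    Continuous fun w : Pairs n → ℂ => noiseMatrix (upper w) := by
  refine continuous_matrix fun j k => ?_
  rcases lt_trichotomy j k with h | h | h
  · simp only [noiseMatrix, upper, Matrix.of_apply, h, if_true, dite_true]
    fun_prop
  · subst h
    simp only [noiseMatrix, Matrix.of_apply, lt_irrefl, if_false]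
    fun_prop
  · simp only [noiseMatrix, upper, Matrix.of_apply, h, h.not_gt, if_true, if_false, dite_true]
    fun_prop

lemma continuous_noiseOp (σ : ℝ) : Continuous fun w : Pairs n → ℂ => noiseOp σ (upper w) :=
  continuous_toOp.comp ((continuous_const_smul ((σ / n : ℝ) : ℂ)).comp continuous_noiseMatrix_upper)

lemma continuous_clip : Continuous clip := by
  unfold clip
  refine continuous_id.div (Complex.continuous_ofReal.comp (by fun_prop)) fun h => ?_
  have : (0 : ℝ) < max ‖h‖ (1 / 20) := lt_max_of_lt_right (by norm_num)
  exact_mod_cast this.ne'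

lemma continuous_clippedPower (zs : Vec n) {X : Type*} [TopologicalSpace X]
    {F : X → Vec n →L[ℂ] Vec n} {g : X → Vec n} (hF : Continuous F) (hg : Continuous g) :
    Continuous fun a => clippedPower zs (F a) (g a) := by
  refine (PiLp.continuous_toLp 2 _).comp (continuous_pi fun j => continuous_clip.comp ?_)
  unfold overlap
  fun_prop

lemma continuous_iterate_clippedPower (zs : Vec n) (k : ℕ) {X : Type*} [TopologicalSpace X]
    {F : X → Vec n →L[ℂ] Vec n} (hF : Continuous F) :
    Continuous fun a => (clippedPower zs (F a))^[k] zs := by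
  induction k with
  | zero => exact continuous_const
  | succ k ih =>
    simp only [Function.iterate_succ_apply']
    exact continuous_clippedPower zs hF ih

lemma continuous_leaveOut (j : Fin n) :
    Continuous fun A : Vec n →L[ℂ] Vec n => leaveOut j A := by
  unfold leaveOut
  generalize eraseCoord j = P
  fun_prop

lemma noiseOp_apply (σ : ℝ) (w : Fin n → Fin n → ℂ) (x : Vec n) :
    noiseOp σ w x = ((σ / n : ℝ) : ℂ) • toOp (noiseMatrix w) x := by
  simp [noiseOp, toOp]

lemma norm_noiseOp {σ : ℝ} (hσ : 0 ≤ σ) (w : Fin n → Fin n → ℂ) :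
    ‖noiseOp σ w‖ = σ / n * ‖toOp (noiseMatrix w)‖ := by
  have : noiseOp σ w = ((σ / n : ℝ) : ℂ) • toOp (noiseMatrix w) := by
    ext1 x
    rw [noiseOp_apply]
    rfl
  rw [this, norm_smul, Complex.norm_real, Real.norm_of_nonneg (by positivity)]

/-- The event that the noise in row `j` is large at the `k`-th leave-one-out iterate. -/
def leaveOutNoisy (σ : ℝ) (zs : Vec n) (k : ℕ) (j : Fin n) : Set (Pairs n → ℂ) :=
  {w | 3 / 4 < ‖noiseOp σ (upper w)
    ((clippedPower zs (leaveOut j (noiseOp σ (upper w))))^[k] zs) j‖}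

lemma measurableSet_leaveOutNoisy (σ : ℝ) (zs : Vec n) (k : ℕ) (j : Fin n) :
    MeasurableSet (leaveOutNoisy σ zs k j) := by
  refine measurableSet_lt measurable_const (Continuous.measurable ?_)
  have h1 := continuous_noiseOp (n := n) σ
  have h2 := continuous_iterate_clippedPower zs k ((continuous_leaveOut j).comp h1)
  exact continuous_norm.comp
    ((EuclideanSpace.proj (𝕜 := ℂ) j).continuous.comp (h1.clm_apply h2))

/-- The leave-one-out iterate is independent of row `j` of the noise, so that this row acts on it as
on a fixed vector. -/
lemma noiseLaw_leaveOutNoisy_le (hn : 0 < n) {σ : ℝ} (hσ : 0 < σ) {zs : Vec n}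
    (hzs : ∀ j, ‖zs j‖ = 1) (k : ℕ) (j : Fin n) :
    (noiseLaw n).real (leaveOutNoisy σ zs k j) ≤ 4 * Real.exp (-(9 / 32 * (n / σ ^ 2))) := by
  have hn' : (0 : ℝ) < n := by exact_mod_cast hn
  let S : Pairs n → Prop := fun p => p.1.1 = j ∨ p.1.2 = j
  classical
  let G : Set ((Pairs n → ℂ) × (Pairs n → ℂ)) :=
    {q | 3 / 4 < ‖noiseOp σ (upper q.1)
      ((clippedPower zs (leaveOut j (noiseOp σ (upper q.2))))^[k] zs) j‖}
  have hG : MeasurableSet G := by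
    refine measurableSet_lt measurable_const (Continuous.measurable ?_)
    have h1 := continuous_noiseOp (n := n) σ
    have h2 := continuous_iterate_clippedPower zs k ((continuous_leaveOut j).comp h1)
    exact continuous_norm.comp ((EuclideanSpace.proj (𝕜 := ℂ) j).continuous.comp
      ((h1.comp continuous_fst).clm_apply (h2.comp continuous_snd)))
  have hrow : ∀ (w w' : Pairs n → ℂ) (y : Vec n),
      noiseOp σ (upper fun p => if S p then w p else w' p) y j = noiseOp σ (upper w) y j := by
    intro w w' y
    rw [noiseOp_apply, noiseOp_apply, PiLp.smul_apply, PiLp.smul_apply, toOp_apply_coord,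
      toOp_apply_coord]
    congr 1
    refine Finset.sum_congr rfl fun l _ => ?_
    simp [noiseMatrix, upper, S]
  have hrest : ∀ w w' : Pairs n → ℂ,
      leaveOut j (noiseOp σ (upper fun p => if S p then w p else w' p)) =
        leaveOut j (noiseOp σ (upper w')) := by
    intro w w'
    ext x l
    rw [leaveOut_apply, leaveOut_apply, eraseCoord_apply, eraseCoord_apply]
    split_ifs with hl
    · rfl
    · rw [noiseOp_apply, noiseOp_apply, PiLp.smul_apply, PiLp.smul_apply, toOp_apply_coord,
        toOp_apply_coord]
      congr 1
      refine Finset.sum_congr rfl fun i _ => ?_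
      rw [eraseCoord_apply]
      by_cases hi : i = j
      · simp [hi]
      · simp [noiseMatrix, upper, S, hl, hi]
  have hdep : ∀ w w' : Pairs n → ℂ, ((fun i => if S i then w i else w' i),
      (fun i => if S i then w i else w' i)) ∈ G ↔ (w, w') ∈ G := by
    intro w w'
    simp only [G, Set.mem_ofPred_eq, hrow, hrest]
  have hK : ∀ w' : Pairs n → ℂ, (noiseLaw n) {w | (w, w') ∈ G} ≤
      ENNReal.ofReal (4 * Real.exp (-(9 / 32 * (n / σ ^ 2)))) := by
    intro w'
    set y := (clippedPower zs (leaveOut j (noiseOp σ (upper w'))))^[k] zs with hy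
    have hyP : y ∈ polydisc n := iterate_clippedPower_mem_polydisc hzs _ _
    have hset : {w | (w, w') ∈ G} =
        {w | 3 / 4 * n / σ < ‖toOp (noiseMatrix (upper w)) y j‖} := by
      ext w
      simp only [G, Set.mem_ofPred_eq, ← hy]
      rw [noiseOp_apply, PiLp.smul_apply, norm_smul, Complex.norm_real,
        Real.norm_of_nonneg (by positivity), div_lt_iff₀ hσ, div_mul_eq_mul_div, lt_div_iff₀ hn',
        mul_comm σ]
    rw [← ofReal_measureReal (measure_ne_top _ _), hset]
    refine ENNReal.ofReal_le_ofReal ((noiseLaw_norm_apply_gt_le hn hyP j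
      (by positivity)).trans_eq ?_)
    congr 2
    field_simp
    norm_num
  have h := pi_measure_le_of_forall_le stdComplexGaussian S hG hdep hK
  refine ENNReal.toReal_le_of_le_ofReal (by positivity) ?_
  exact h

/-- The event that the noise matrix has an exceptionally large operator norm. -/
def largeNoise (n : ℕ) : Set (Pairs n → ℂ) := {w | 24 * √n < ‖toOp (noiseMatrix (upper w))‖}

lemma measurableSet_largeNoise (n : ℕ) : MeasurableSet (largeNoise n) :=
  measurableSet_lt measurable_const
    (continuous_norm.comp (continuous_toOp.comp continuous_noiseMatrix_upper)).measurable

open scoped Classical in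
/-- Off the event of large noise, the loss is bounded by the number of coordinates with large noise
at a leave-one-out iterate of sufficiently high order. -/
lemma exists_frobNorm_sub_outer_sq_le_card (hn : 0 < n) {σ : ℝ} (hσ : 0 < σ)
    (hσn : σ ≤ 1 / 240000 * √n) {zs : Fin n → ℂ} (hzs : zs ∈ phases n) :
    ∃ k : ℕ, ∀ m : ℕ, 1 ≤ m → ∀ w : Fin n → Fin n → ℂ,
      (fun p : Pairs n => w p.1.1 p.1.2) ∉ largeNoise n →
      ∀ Z z, IsBM m (observation zs σ w) Z → IsMLE (observation zs σ w) z →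
        frobNorm (Z - outer z) ^ 2 ≤ 32 * n * (Finset.univ.filter fun j =>
          (fun p : Pairs n => w p.1.1 p.1.2) ∈ leaveOutNoisy σ (WithLp.toLp 2 zs) k j).card := by
  have hn' : (0 : ℝ) < n := by exact_mod_cast hn
  obtain ⟨k, hk⟩ := exists_pow_lt_of_lt_one (x := 1 / (2 * √(n : ℝ))) (y := (1 / 2 : ℝ))
    (by positivity) (by norm_num)
  have hk' : (1 / 2 : ℝ) ^ k * (2 * √n) ≤ 1 := by
    rw [lt_div_iff₀ (by positivity)] at hk
    exact hk.le
  refine ⟨k, fun m hm w hw Z z hZ hz => ?_⟩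
  set v : Pairs n → ℂ := fun p => w p.1.1 p.1.2 with hv
  have hop : noiseOp σ w = noiseOp σ (upper v) := by
    rw [noiseOp, noiseOp, hv, noiseMatrix_upper]
  have hA : ‖noiseOp σ w‖ ≤ 1 / 10000 := by
    have h1 : ‖toOp (noiseMatrix (upper v))‖ ≤ 24 * √n := by
      simpa [largeNoise] using hw
    rw [hop, norm_noiseOp hσ.le]
    calc σ / n * ‖toOp (noiseMatrix (upper v))‖ ≤ 1 / 240000 * √n / n * (24 * √n) := by gcongr
      _ = 24 / 240000 * (√n * √n) / n := by ring
      _ = 1 / 10000 := by rw [Real.mul_self_sqrt hn'.le]; field_simp; norm_num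
  have hzs' : ∀ j, ‖(WithLp.toLp 2 zs : Vec n) j‖ = 1 := hzs
  obtain ⟨x, hx⟩ := exists_clippedPower_eq_self hzs' hA
  refine (frobNorm_sub_outer_sq_le_card hn hm hzs hA hx hZ hz).trans ?_
  gcongr
  intro j hj
  have hj' : 4 / 5 < ‖noiseOp σ w x j‖ := by simpa [noisyCoords] using hj
  have := lt_norm_apply_iterate_leaveOut hzs' hA hx hj' hk'
  rw [hop] at this
  exact Finset.mem_filter.2 ⟨Finset.mem_univ j, this⟩

/-! ### Expectation and high probability bounds -/

section Bounds

variable {Ω : Type*} [MeasurableSpace Ω] {μ : Measure Ω} [IsProbabilityMeasure μ]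
  {ξ : Fin n → Fin n → Ω → ℂ}

lemma IsNoise.measureReal_preimage (hξ : IsNoise μ ξ) {B : Set (Pairs n → ℂ)}
    (hB : MeasurableSet B) :
    μ.real {ω | (fun p : Pairs n => ξ p.1.1 p.1.2 ω) ∈ B} = (noiseLaw n).real B := by
  rw [← hξ.map_eq, map_measureReal_apply_of_aemeasurable hξ.aemeasurable hB]
  rfl

lemma integrable_loss {m : ℕ} {Y : Ω → Matrix (Fin n) (Fin n) ℂ}
    {Zhat : Ω → Matrix (Fin n) (Fin n) ℂ} {zhat : Ω → Fin n → ℂ}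
    (hZm : ∀ j k, AEMeasurable (fun ω => Zhat ω j k) μ)
    (hzm : ∀ j, AEMeasurable (fun ω => zhat ω j) μ)
    (hZ : ∀ᵐ ω ∂μ, IsBM m (Y ω) (Zhat ω)) (hz : ∀ᵐ ω ∂μ, IsMLE (Y ω) (zhat ω)) :
    Integrable (fun ω => 1 / (n : ℝ) ^ 2 * frobNorm (Zhat ω - outer (zhat ω)) ^ 2) μ := by
  have hmeas : AEMeasurable
      (fun ω => 1 / (n : ℝ) ^ 2 * frobNorm (Zhat ω - outer (zhat ω)) ^ 2) μ := by
    simp only [frobNorm_sq]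
    refine AEMeasurable.const_mul (Finset.aemeasurable_fun_sum _ fun j _ =>
      Finset.aemeasurable_fun_sum _ fun k _ => ?_) _
    have h1 : AEMeasurable (fun ω => outer (zhat ω) j k) μ :=
      (hzm j).mul (Complex.continuous_conj.measurable.comp_aemeasurable (hzm k))
    exact (((hZm j k).sub h1).norm).pow_const 2
  refine Integrable.of_bound hmeas.aestronglyMeasurable (1 / (n : ℝ) ^ 2 * (4 * n ^ 2)) ?_
  filter_upwards [hZ, hz] with ω h1 h2
  rw [Real.norm_of_nonneg (by positivity)]
  gcongr
  exact frobNorm_sub_outer_sq_le h1.1 h2.1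

/-- In the low noise regime the expected loss is the exponentially small probability of a noisy
coordinate, up to the contribution of the event of large noise. -/
lemma integral_loss_le (hn : 0 < n) {m : ℕ} (hm : 1 ≤ m) {σ : ℝ} (hσ : 0 < σ)
    (hσn : σ ≤ 1 / 240000 * √n) {zs : Fin n → ℂ} (hzs : zs ∈ phases n) (hξ : IsNoise μ ξ)
    {Zhat : Ω → Matrix (Fin n) (Fin n) ℂ} {zhat : Ω → Fin n → ℂ}
    (hZm : ∀ j k, AEMeasurable (fun ω => Zhat ω j k) μ)
    (hzm : ∀ j, AEMeasurable (fun ω => zhat ω j) μ)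
    (hZ : ∀ᵐ ω ∂μ, IsBM m (observation zs σ (fun j k => ξ j k ω)) (Zhat ω))
    (hz : ∀ᵐ ω ∂μ, IsMLE (observation zs σ (fun j k => ξ j k ω)) (zhat ω)) :
    ∫ ω, 1 / (n : ℝ) ^ 2 * frobNorm (Zhat ω - outer (zhat ω)) ^ 2 ∂μ ≤
      4 * Real.exp (-(11 * n)) + 128 * Real.exp (-(9 / 32 * (n / σ ^ 2))) := by
  classical
  have hn' : (0 : ℝ) < n := by exact_mod_cast hn
  obtain ⟨k, hk⟩ := exists_frobNorm_sub_outer_sq_le_card hn hσ hσn hzs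
  let X : Ω → Pairs n → ℂ := fun ω p => ξ p.1.1 p.1.2 ω
  let B : Fin n → Set (Pairs n → ℂ) := leaveOutNoisy σ (WithLp.toLp 2 zs) k
  have hind : ∀ D : Set (Pairs n → ℂ), MeasurableSet D →
      Integrable ((X ⁻¹' D).indicator fun _ => (1 : ℝ)) μ ∧
        ∫ ω, (X ⁻¹' D).indicator (fun _ => (1 : ℝ)) ω ∂μ = (noiseLaw n).real D := by
    intro D hD
    have hnull : NullMeasurableSet (X ⁻¹' D) μ := hξ.aemeasurable.nullMeasurableSet_preimage hD
    refine ⟨(integrable_const (1 : ℝ)).indicator₀ hnull, ?_⟩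
    rw [integral_indicator₀ hnull, setIntegral_const, smul_eq_mul, mul_one]
    exact hξ.measureReal_preimage hD
  have hBm : ∀ j, MeasurableSet (B j) := measurableSet_leaveOutNoisy σ _ k
  let F : Ω → ℝ := fun ω => 4 * (X ⁻¹' largeNoise n).indicator (fun _ => (1 : ℝ)) ω +
    32 / n * ∑ j, (X ⁻¹' B j).indicator (fun _ => (1 : ℝ)) ω
  have hsumint : Integrable (fun ω => ∑ j, (X ⁻¹' B j).indicator (fun _ => (1 : ℝ)) ω) μ :=
    integrable_finsetSum _ fun j _ => (hind _ (hBm j)).1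
  have hFint : Integrable F μ :=
    ((hind _ (measurableSet_largeNoise n)).1.const_mul 4).add (hsumint.const_mul _)
  have hle : ∀ᵐ ω ∂μ, 1 / (n : ℝ) ^ 2 * frobNorm (Zhat ω - outer (zhat ω)) ^ 2 ≤ F ω := by
    filter_upwards [hZ, hz] with ω h1 h2
    have hsum : ∑ j, (X ⁻¹' B j).indicator (fun _ => (1 : ℝ)) ω =
        (Finset.univ.filter fun j => X ω ∈ B j).card := by
      simp only [Set.indicator_apply, Set.mem_preimage]
      rw [Finset.sum_boole]
    have hF : F ω = 4 * (X ⁻¹' largeNoise n).indicator (fun _ => (1 : ℝ)) ω +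
        32 / n * (Finset.univ.filter fun j => X ω ∈ B j).card := by rw [← hsum]
    rw [hF]
    by_cases hω : X ω ∈ largeNoise n
    · have h3 := frobNorm_sub_outer_sq_le h1.1 h2.1
      have h4 : 1 / (n : ℝ) ^ 2 * frobNorm (Zhat ω - outer (zhat ω)) ^ 2 ≤ 4 := by
        rw [one_div, inv_mul_le_iff₀ (by positivity)]
        linarith
      rw [Set.indicator_of_mem (Set.mem_preimage.2 hω)]
      have h5 : (0 : ℝ) ≤ 32 / n * (Finset.univ.filter fun j => X ω ∈ B j).card := by positivity
      linarith
    · have h3 := hk m hm (fun j l => ξ j l ω) hω _ _ h1 h2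
      rw [Set.indicator_of_notMem (fun h => hω (Set.mem_preimage.1 h)), mul_zero, zero_add]
      rw [one_div, inv_mul_le_iff₀ (by positivity)]
      refine h3.trans_eq ?_
      field_simp
      rfl
  calc ∫ ω, 1 / (n : ℝ) ^ 2 * frobNorm (Zhat ω - outer (zhat ω)) ^ 2 ∂μ ≤ ∫ ω, F ω ∂μ :=
        integral_mono_ae (integrable_loss hZm hzm hZ hz) hFint hle
    _ = 4 * (noiseLaw n).real (largeNoise n) + 32 / n * ∑ j, (noiseLaw n).real (B j) := by
        rw [integral_add ((hind _ (measurableSet_largeNoise n)).1.const_mul 4)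
          (hsumint.const_mul _), integral_const_mul, integral_const_mul,
          integral_finsetSum _ fun j _ => (hind _ (hBm j)).1,
          (hind _ (measurableSet_largeNoise n)).2]
        simp only [(hind _ (hBm _)).2]
    _ ≤ 4 * Real.exp (-(11 * n)) +
        32 / n * ∑ _j : Fin n, 4 * Real.exp (-(9 / 32 * (n / σ ^ 2))) := by
        gcongr with j _
        · exact noiseLaw_opNorm_gt_le n
        · exact noiseLaw_leaveOutNoisy_le hn hσ (zs := WithLp.toLp 2 zs) hzs k j
    _ = _ := by
        rw [Finset.sum_const, Finset.card_univ, Fintype.card_fin, nsmul_eq_mul]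
        generalize Real.exp (-(9 / 32 * (n / σ ^ 2))) = a
        field_simp
        ring

lemma exp_neg_eleven_mul_le (hn : 0 < n) :
    4 * Real.exp (-(11 * n)) ≤ 2 * (n : ℝ) ^ (-10 : ℤ) := by
  have hn' : (0 : ℝ) < n := by exact_mod_cast hn
  have hn1 : (1 : ℝ) ≤ n := by exact_mod_cast hn
  have h1 : (n : ℝ) ^ 10 ≤ Real.exp (10 * n) := by
    have h2 : (n : ℝ) ≤ Real.exp n := by linarith [Real.add_one_le_exp (n : ℝ)]
    calc (n : ℝ) ^ 10 ≤ Real.exp n ^ 10 := by gcongr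
      _ = Real.exp (10 * n) := by rw [← Real.exp_nat_mul]; norm_num
  have h3 : (2 : ℝ) ≤ Real.exp n := by linarith [Real.add_one_le_exp (n : ℝ)]
  have h4 : Real.exp (11 * n) = Real.exp (10 * n) * Real.exp n := by
    rw [← Real.exp_add]; congr 1; ring
  rw [zpow_neg, Real.exp_neg, ← div_eq_mul_inv, ← div_eq_mul_inv,
    div_le_div_iff₀ (Real.exp_pos _) (by positivity), h4]
  have h5 : (n : ℝ) ^ 10 * 2 ≤ Real.exp (10 * n) * Real.exp n := by gcongr
  have h6 : (n : ℝ) ^ (10 : ℤ) = (n : ℝ) ^ 10 := by norm_cast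
  rw [h6]
  linarith

/-- In the high noise regime the trivial bound on the loss suffices. -/
lemma integral_loss_le_four {m : ℕ} {Y : Ω → Matrix (Fin n) (Fin n) ℂ} (hn : 0 < n)
    {Zhat : Ω → Matrix (Fin n) (Fin n) ℂ} {zhat : Ω → Fin n → ℂ}
    (hZm : ∀ j k, AEMeasurable (fun ω => Zhat ω j k) μ)
    (hzm : ∀ j, AEMeasurable (fun ω => zhat ω j) μ)
    (hZ : ∀ᵐ ω ∂μ, IsBM m (Y ω) (Zhat ω)) (hz : ∀ᵐ ω ∂μ, IsMLE (Y ω) (zhat ω)) :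
    ∫ ω, 1 / (n : ℝ) ^ 2 * frobNorm (Zhat ω - outer (zhat ω)) ^ 2 ∂μ ≤ 4 := by
  have hn' : (0 : ℝ) < n := by exact_mod_cast hn
  calc ∫ ω, 1 / (n : ℝ) ^ 2 * frobNorm (Zhat ω - outer (zhat ω)) ^ 2 ∂μ ≤ ∫ _ω, (4 : ℝ) ∂μ := by
        refine integral_mono_ae (integrable_loss hZm hzm hZ hz) (integrable_const _) ?_
        filter_upwards [hZ, hz] with ω h1 h2
        rw [one_div, inv_mul_le_iff₀ (by positivity)]
        linarith [frobNorm_sub_outer_sq_le h1.1 h2.1]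
    _ = 4 := by simp

/-- The union bound over the noisy coordinates. -/
lemma exists_event_eq_outer (hn : 2 ≤ n) {m : ℕ} (hm : 1 ≤ m) {σ : ℝ} (hσ : 0 < σ)
    (hσn : σ ≤ 1 / 240000 * √n) (hσlog : σ ≤ √(n / (9 * Real.log n))) {zs : Fin n → ℂ}
    (hzs : zs ∈ phases n) (hξ : IsNoise μ ξ) :
    ∃ E : Set Ω, MeasurableSet E ∧ 1 - 1 / (n : ℝ) ≤ μ.real E ∧
      ∀ ω ∈ E, ∀ (Z : Matrix (Fin n) (Fin n) ℂ) (z : Fin n → ℂ),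
        IsBM m (observation zs σ (fun j k => ξ j k ω)) Z →
        IsMLE (observation zs σ (fun j k => ξ j k ω)) z → Z = outer z := by
  classical
  have hn0 : 0 < n := by omega
  have hn' : (0 : ℝ) < n := by exact_mod_cast hn0
  have hn2 : (2 : ℝ) ≤ n := by exact_mod_cast hn
  have hlog : 0 < Real.log n := Real.log_pos (by linarith)
  obtain ⟨k, hk⟩ := exists_frobNorm_sub_outer_sq_le_card hn0 hσ hσn hzs
  let B : Fin n → Set (Pairs n → ℂ) := leaveOutNoisy σ (WithLp.toLp 2 zs) k
  have hBm : ∀ j, MeasurableSet (B j) := measurableSet_leaveOutNoisy σ _ k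
  let D : Set (Pairs n → ℂ) := largeNoise n ∪ ⋃ j, B j
  have hDm : MeasurableSet D := (measurableSet_largeNoise n).union (MeasurableSet.iUnion hBm)
  let bad : Set Ω := {ω | (fun p : Pairs n => ξ p.1.1 p.1.2 ω) ∈ D}
  have hsnr1 : 9 * Real.log n ≤ n / σ ^ 2 := by
    have h1 : σ ^ 2 ≤ n / (9 * Real.log n) := (Real.le_sqrt hσ.le (by positivity)).1 hσlog
    rw [le_div_iff₀ (by positivity)] at h1 ⊢
    linarith
  have hsnr2 : 240000 ^ 2 ≤ n / σ ^ 2 := by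
    have h1 : σ ^ 2 ≤ (1 / 240000 * √n) ^ 2 := by gcongr
    rw [mul_pow, Real.sq_sqrt hn'.le] at h1
    rw [le_div_iff₀ (by positivity)]
    linarith
  -- The exponent `9 / 32` exceeds the needed `2 / 9`; the excess absorbs the constants.
  have hexp : Real.exp (-(9 / 32 * (n / σ ^ 2))) ≤ 1 / 8 * (1 / (n : ℝ) ^ 2) := by
    have h1 : -(9 / 32 * (n / σ ^ 2)) ≤ -8 + -(2 * Real.log n) := by linarith
    have h2 : Real.exp (-(2 * Real.log n)) = 1 / (n : ℝ) ^ 2 := by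
      rw [Real.exp_neg, two_mul, Real.exp_add, Real.exp_log hn', one_div, sq]
    have h3 : Real.exp (-8) ≤ 1 / 8 := by
      rw [Real.exp_neg, one_div]
      exact inv_anti₀ (by norm_num) (by linarith [Real.add_one_le_exp (8 : ℝ)])
    calc _ ≤ Real.exp (-8 + -(2 * Real.log n)) := Real.exp_le_exp.2 h1
      _ = Real.exp (-8) * (1 / (n : ℝ) ^ 2) := by rw [Real.exp_add, h2]
      _ ≤ _ := by gcongr
  have hexp2 : Real.exp (-(11 * n)) ≤ 1 / (2 * n) := by
    rw [Real.exp_neg, one_div]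
    exact inv_anti₀ (by positivity) (by linarith [Real.add_one_le_exp (11 * n : ℝ)])
  have hbad : μ.real bad ≤ 1 / n := by
    calc μ.real bad = (noiseLaw n).real D := hξ.measureReal_preimage hDm
      _ ≤ (noiseLaw n).real (largeNoise n) + ∑ j, (noiseLaw n).real (B j) :=
          (measureReal_union_le _ _).trans (by gcongr; exact measureReal_iUnion_fintype_le _)
      _ ≤ Real.exp (-(11 * n)) + ∑ _j : Fin n, 4 * Real.exp (-(9 / 32 * (n / σ ^ 2))) := by
          gcongr with j _
          · exact noiseLaw_opNorm_gt_le n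
          · exact noiseLaw_leaveOutNoisy_le hn0 hσ (zs := WithLp.toLp 2 zs) hzs k j
      _ = Real.exp (-(11 * n)) + n * (4 * Real.exp (-(9 / 32 * (n / σ ^ 2)))) := by simp
      _ ≤ 1 / (2 * n) + n * (4 * (1 / 8 * (1 / (n : ℝ) ^ 2))) := by gcongr
      _ = 1 / n := by field_simp; norm_num
  refine ⟨(toMeasurable μ bad)ᶜ, (measurableSet_toMeasurable _ _).compl, ?_, ?_⟩
  · rw [measureReal_compl (measurableSet_toMeasurable _ _), probReal_univ, Measure.real,
      measure_toMeasurable]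
    have : (μ bad).toReal ≤ 1 / n := hbad
    linarith
  · intro ω hω Z z hZ hz
    have hω' : ω ∉ bad := fun h => hω (subset_toMeasurable μ bad h)
    have h1 : (fun p : Pairs n => ξ p.1.1 p.1.2 ω) ∉ largeNoise n := fun h => hω' (Or.inl h)
    have h2 : ∀ j, (fun p : Pairs n => ξ p.1.1 p.1.2 ω) ∉ B j :=
      fun j h => hω' (Or.inr (Set.mem_iUnion.2 ⟨j, h⟩))
    have h3 := hk m hm (fun j l => ξ j l ω) h1 Z z hZ hz
    rw [Finset.filter_false_of_mem fun j _ => h2 j, Finset.card_empty, Nat.cast_zero,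
      mul_zero] at h3
    exact eq_of_frobNorm_sub_sq_le_zero h3

end Bounds

end PhaseSync

end

theorem theorem1 :
    (∃ C : ℝ, 0 < C ∧
      ∀ (n m : ℕ), 1 ≤ n → 2 ≤ m →
      ∀ (σ : ℝ), 0 < σ →
      ∀ (zs : Fin n → ℂ), zs ∈ PhaseSync.phases n →
      ∀ (Ω : Type*) [MeasurableSpace Ω] (μ : Measure Ω) [IsProbabilityMeasure μ]
        (ξ : Fin n → Fin n → Ω → ℂ), PhaseSync.IsNoise μ ξ →
      ∀ (Zhat : Ω → Matrix (Fin n) (Fin n) ℂ) (zhat : Ω → Fin n → ℂ),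
        (∀ j k, AEMeasurable (fun ω => Zhat ω j k) μ) →
        (∀ j, AEMeasurable (fun ω => zhat ω j) μ) →
        (∀ᵐ ω ∂μ, PhaseSync.IsBM m
          (PhaseSync.observation zs σ (fun j k => ξ j k ω)) (Zhat ω)) →
        (∀ᵐ ω ∂μ, PhaseSync.IsMLE
          (PhaseSync.observation zs σ (fun j k => ξ j k ω)) (zhat ω)) →
        Integrable (fun ω => 1 / (n : ℝ) ^ 2 *
          PhaseSync.frobNorm (Zhat ω - PhaseSync.outer (zhat ω)) ^ 2) μ ∧
        ∫ ω, 1 / (n : ℝ) ^ 2 *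
            PhaseSync.frobNorm (Zhat ω - PhaseSync.outer (zhat ω)) ^ 2 ∂μ
          ≤ C * Real.exp (-((n : ℝ) / (8 * σ ^ 2))) + 2 * (n : ℝ) ^ (-10 : ℤ)) ∧
    (∃ C' : ℝ, 0 < C' ∧
      ∀ (n m : ℕ), 2 ≤ n → 2 ≤ m →
      ∀ (σ : ℝ), 0 < σ → σ ≤ min (C' * √(n : ℝ)) (√((n : ℝ) / (9 * Real.log n))) →
      ∀ (zs : Fin n → ℂ), zs ∈ PhaseSync.phases n →
      ∀ (Ω : Type*) [MeasurableSpace Ω] (μ : Measure Ω) [IsProbabilityMeasure μ]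
        (ξ : Fin n → Fin n → Ω → ℂ), PhaseSync.IsNoise μ ξ →
      ∃ E : Set Ω, MeasurableSet E ∧ 1 - 1 / (n : ℝ) ≤ μ.real E ∧
        ∀ ω ∈ E, ∀ (Z : Matrix (Fin n) (Fin n) ℂ) (z : Fin n → ℂ),
          PhaseSync.IsBM m (PhaseSync.observation zs σ (fun j k => ξ j k ω)) Z →
          PhaseSync.IsMLE (PhaseSync.observation zs σ (fun j k => ξ j k ω)) z →
          Z = PhaseSync.outer z) := by
  constructor
  · -- Above the threshold `1 / 240000` for `σ / √n` the exponential is bounded below.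
    refine ⟨128 * Real.exp (240000 ^ 2), by positivity, ?_⟩
    intro n m hn hm σ hσ zs hzs Ω _ μ _ ξ hξ Zhat zhat hZm hzm hZ hz
    refine ⟨PhaseSync.integrable_loss hZm hzm hZ hz, ?_⟩
    have hn' : (0 : ℝ) < n := by exact_mod_cast hn
    have hz0 : (0 : ℝ) ≤ 2 * (n : ℝ) ^ (-10 : ℤ) := by positivity
    have hrw : (n : ℝ) / (8 * σ ^ 2) = 1 / 8 * (n / σ ^ 2) := by field_simp
    have hsnr : 0 ≤ n / σ ^ 2 := by positivity
    rw [hrw]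
    rcases le_or_gt σ (1 / 240000 * √n) with hσn | hσn
    · have h1 := PhaseSync.integral_loss_le hn (by omega) hσ hσn hzs hξ hZm hzm hZ hz
      have h2 := PhaseSync.exp_neg_eleven_mul_le hn
      have h3 : Real.exp (-(9 / 32 * (n / σ ^ 2))) ≤ Real.exp (-(1 / 8 * (n / σ ^ 2))) :=
        Real.exp_le_exp.2 (by linarith)
      have h4 : 1 ≤ Real.exp (240000 ^ 2) := Real.one_le_exp (by positivity)
      have h5 : 128 * Real.exp (-(9 / 32 * (n / σ ^ 2))) ≤
          128 * Real.exp (240000 ^ 2) * Real.exp (-(1 / 8 * (n / σ ^ 2))) := by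
        calc _ ≤ 128 * 1 * Real.exp (-(1 / 8 * (n / σ ^ 2))) := by linarith
          _ ≤ _ := by gcongr
      linarith
    · have h1 := PhaseSync.integral_loss_le_four hn hZm hzm hZ hz
      have h2 : (n : ℝ) / σ ^ 2 ≤ 240000 ^ 2 := by
        have h3 : (1 / 240000 * √n) ^ 2 ≤ σ ^ 2 := by gcongr
        rw [mul_pow, Real.sq_sqrt hn'.le] at h3
        rw [div_le_iff₀ (by positivity)]
        linarith
      have h4 : 1 ≤ Real.exp (240000 ^ 2) * Real.exp (-(1 / 8 * (n / σ ^ 2))) := by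
        rw [← Real.exp_add]
        exact Real.one_le_exp (by linarith)
      rw [mul_assoc]
      linarith
  · refine ⟨1 / 240000, by norm_num, ?_⟩
    intro n m hn hm σ hσ hσn zs hzs Ω _ μ _ ξ hξ
    exact PhaseSync.exists_event_eq_outer hn (by omega) hσ (hσn.trans (min_le_left _ _))
      (hσn.trans (min_le_right _ _)) hzs hξ
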